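/- A *secant tree* of size $2n$ ($n\ge 1$) is a planar rooted binary tree (each child is either a left or a right child) with $2n$ nodes labelled $1,\dots,2n$, labels increasing from parent to child, in which every node is a leaf or has two children, except the rightmost node, which has a left child and no right child. For such a tree $t$, $\mathrm{eoc}(t)$ is the label of the leaf reached from the root by moving at each step to the child with the smallest label (the only child, if there is just one), and $\mathrm{pom}(t)$ is the label of the parent of the leaf labelled $2n$. Let $$f_{2n}(m,k)=\#\{t:\ \mathrm{eoc}(t)=m,\ \mathrm{pom}(t)=k\}\qquad(2\le m\le 2n,\ 1\le k\le 2n-1),$$ with row sums $f_{2n}(m,\bullet)=\sum_{k=1}^{2n-1} f_{2n}(m,k)$, column sums $f_{2n}(\bullet,k)=\sum_{m=2}^{2n} f_{2n}(m,k)$, and total sum $f_{2n}(\bullet,\bullet)$. Let $E_{2n}$ be the secant numbers, $\sec u=\sum_{n\ge0}E_{2n}u^{2n}/(2n)!$. Write $\Delta_m,\Delta_k$ for the forward differences (step $1$) in $m$ and in $k$. **Theorem.** (a) The following relations hold for all $n\ge 2$: * (R1) $\Delta_m^2 f_{2n}(m,k)+4f_{2n-2}(m,k-2)=0$ for $2\le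 m\le k-3<k\le 2n-1$; * (R2) $\Delta_k^2 f_{2n}(m,k)+4f_{2n-2}(m,k)=0$ for $2\le m\le k-1<k\le 2n-3$; * (1.7) $f_{2n}(2,k)=f_{2n-2}(\bullet,k-2)=f_{2n-2}(k-1,\bullet)$ for $3\le k\le 2n-1$; $f_{2n}(3,k)=3f_{2n}(2,k)$ for $4\le k\le 2n-1$; $f_{2n}(m,2n-1)=f_{2n-2}(m,\bullet)=f_{2n-2}(\bullet,m-1)$ for $2\le m\le 2n-2$; $f_{2n}(m,2n-2)=3f_{2n}(m,2n-1)$ for $2\le m\le 2n-3$; * (1.8) $f_2(\bullet,1)=1$ and $f_{2n}(\bullet,1)=f_{2n-2}(\bullet,\bullet)=E_{2n-2}$; * (1.9) $f_{2n}(\bullet,2)=3f_{2n-2}(\bullet,\bullet)$; * (R3) $\Delta_m^2 f_{2n}(m,\bullet)+4f_{2n-2}(m,\bullet)=0$ for $2\le m\le 2n-2$; * (R4) $\Delta_k^2 f_{2n}(\bullet,k)+4f_{2n-2}(\bullet,k)=0$ for $1\le k\le 2n-3$. (b) Consider the following algorithm, which for $n=1,2,3,\dots$ computes numbers $r_{2n}(m)$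 ($2\le m\le 2n$), $c_{2n}(k)$ ($1\le k\le 2n-1$) and $u_{2n}(m,k)$ ($2\le m<k\le 2n-1$), each size from the preceding one. Start with $r_2(2)=c_2(1)=1$ (and no $u_2$). For $n\ge2$ let $T=\sum_{j=1}^{2n-3}c_{2n-2}(j)$. * Sums, by a choice of one of two rules. Rule R4: $c_{2n}(1)=T$, $c_{2n}(2)=3T$, $c_{2n}(k+2)=2c_{2n}(k+1)-c_{2n}(k)-4c_{2n-2}(k)$ for $1\le k\le 2n-3$, and $r_{2n}(m)=c_{2n}(m-1)$. Rule R3: $r_{2n}(2)=T$, $r_{2n}(3)=3T$, $r_{2n}(m+2)=2r_{2n}(m+1)-r_{2n}(m)-4r_{2n-2}(m)$ for $2\le m\le 2n-2$, and $c_{2n}(k)=r_{2n}(k+1)$. * Upper triangle, by a choice of one of two rules. Rule R1 (from the two top rows downwards): $u_{2n}(2,k)=c_{2n-2}(k-2)$ for $3\le k\le 2n-1$, $u_{2n}(3,k)=3c_{2n-2}(k-2)$ for $4\le k\le 2n-1$, and $u_{2n}(m+2,k)=2u_{2n}(m+1,k)-u_{2n}(m,k)-4u_{2n-2}(m,k-2)$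 for $2\le m\le k-3<k\le2n-1$. Rule R2 (from the two rightmost columns to the left): $u_{2n}(m,2n-1)=r_{2n-2}(m)$ for $2\le m\le 2n-2$, $u_{2n}(m,2n-2)=3r_{2n-2}(m)$ for $2\le m\le 2n-3$, and $u_{2n}(m,k)=2u_{2n}(m,k+1)-u_{2n}(m,k+2)-4u_{2n-2}(m,k)$ for $2\le m<k\le 2n-3$. For each of the four choices of rules and all $n\ge1$, the algorithm is correct: $$r_{2n}(m)=f_{2n}(m,\bullet)\ (2\le m\le 2n),\quad c_{2n}(k)=f_{2n}(\bullet,k)\ (1\le k\le 2n-1),\quad u_{2n}(m,k)=f_{2n}(m,k)\ (2\le m<k\le 2n-1).$$ (c) The relations in (a) suffice for this: if integers $g_{2n}(m,k)$ satisfy all the relations in (a) (with $g$ and its row, column and total sums over the same ranges in place of $f$), then for each choice of rules and all $n\ge1$ the algorithm returns the row sums, the column sums and the upper-triangle entries $g_{2n}(m,k)$, $2\le m<k\le 2n-1$, of $g$. -/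

import Mathlib

namespace SecantTree

open BinaryTree

/-! ### Labelled binary trees

A planar tree in which every node has at most one left child and at most one right child, with
natural-number labels, is a term of `BinaryTree ℕ`; the empty tree is `nil`. -/

/-- The label of the root, if the tree is not empty. -/
def rootLabel : BinaryTree ℕ → Option ℕ
  | nil => none
  | node a _ _ => some a

/-- The labels of the nodes read from left to right (the projection of the tree on a horizontal
axis). -/
def labels : BinaryTree ℕ → List ℕ
  | nil => []
  | node a l r => labels l ++ a :: labels r

/-- The label of each node is smaller than the labels of its children. -/
def LabelsIncrease : BinaryTree ℕ → Prop
  | nil => True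
  | node a l r =>
      (∀ b ∈ rootLabel l, a < b) ∧ (∀ b ∈ rootLabel r, a < b) ∧
        LabelsIncrease l ∧ LabelsIncrease r

/-- `t` is an increasing tree of size `N`: its nodes are labelled `1, 2, …, N`, each label being
used exactly once, and labels increase from parent to child (so that the root is labelled `1` when
`N ≥ 1`). -/
def IsIncreasingTree (N : ℕ) (t : BinaryTree ℕ) : Prop :=
  (labels t).Perm (List.range' 1 N) ∧ LabelsIncrease t

/-- Every node is a leaf or has two children. -/
def LeafOrTwoChildren : BinaryTree ℕ → Prop
  | nil => True
  | node _ l r => (l = nil ↔ r = nil) ∧ LeafOrTwoChildren l ∧ LeafOrTwoChildren r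

/-- Every node is a leaf or has two children, except the rightmost node (the last one on the path
that starts from the root and always goes to the right child), which has a left child but no right
child. -/
def HasOneChildRightmost : BinaryTree ℕ → Prop
  | nil => False
  | node _ l nil => l ≠ nil ∧ LeafOrTwoChildren l
  | node _ l (node b l' r') =>
      l ≠ nil ∧ LeafOrTwoChildren l ∧ HasOneChildRightmost (node b l' r')

/-- `t` is a secant tree of size `2 * n`, that is, a complete increasing tree of even size
`2 * n`. -/
def IsSecantTree (n : ℕ) (t : BinaryTree ℕ) : Prop :=
  IsIncreasingTree (2 * n) t ∧ HasOneChildRightmost t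

/-! ### The two statistics -/

/-- The end of the minimal chain: start from the root and move to the child with the smallest
label (to the only child if there is just one) until a leaf is reached. -/
def eoc : BinaryTree ℕ → ℕ
  | nil => 0
  | node a nil nil => a
  | node _ (node b l r) nil => eoc (node b l r)
  | node _ nil (node c l r) => eoc (node c l r)
  | node _ (node b l r) (node c l' r') =>
      if b < c then eoc (node b l r) else eoc (node c l' r')

/-- The label of the parent of the node labelled `j`, if there is such a node and it is not the
root. -/
def parentLabel (j : ℕ) : BinaryTree ℕ → Option ℕ
  | nil => none
  | node a l r =>
      if rootLabel l = some j ∨ rootLabel r = some j then some a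
      else (parentLabel j l).orElse fun _ => parentLabel j r

/-- The parent of the maximum leaf of a tree of size `N`, that is, of the node labelled `N`. -/
def pom (N : ℕ) (t : BinaryTree ℕ) : Option ℕ := parentLabel N t

/-! ### The joint distribution -/

/-- The set of the secant trees of size `2 * n` with `eoc = m` and `pom = k`. -/
def treesWith (n m k : ℕ) : Set (BinaryTree ℕ) :=
  {t | IsSecantTree n t ∧ eoc t = m ∧ pom (2 * n) t = some k}

/-- `f n m k` is the number `f_{2n}(m, k)` of the secant trees of size `2 * n` with `eoc = m` and
`pom = k`, as an integer. -/
noncomputable def f (n m k : ℕ) : ℤ := ((treesWith n m k).ncard : ℤ)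

/-- The sets that are counted are finite. -/
theorem finite_treesWith (n m k : ℕ) : (treesWith n m k).Finite := by
  have key : ∀ (L : List ℕ), {t : BinaryTree ℕ | labels t = L}.Finite := by
    intro L
    induction h : L.length using Nat.strong_induction_on generalizing L with
    | _ N ih =>
      subst h
      have hsub : {t : BinaryTree ℕ | labels t = L} ⊆ {nil} ∪
          ⋃ i ∈ Finset.range L.length, Set.image2 (fun l r => node (L.getD i 0) l r)
            {t | labels t = L.take i} {t | labels t = L.drop (i + 1)} := by
        intro t ht
        cases t with
        | nil => simp
        | node a l r =>
          right
          change labels l ++ a :: labels r = L at ht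
          subst ht
          simp only [Set.mem_iUnion]
          refine ⟨(labels l).length, by simp, l, by simp, r, ?_, by simp⟩
          simp [List.drop_append]
      refine Set.Finite.subset ?_ hsub
      refine (Set.finite_singleton _).union ?_
      refine Set.Finite.biUnion (Finset.finite_toSet _) fun i hi => ?_
      have hi' : i < L.length := by simpa using hi
      refine Set.Finite.image2 _ (ih _ ?_ _ rfl) (ih _ ?_ _ rfl)
      · simp; omega
      · simp; omega
  have hfin : (⋃ L ∈ {L : List ℕ | L.Perm (List.range' 1 (2 * n))},
      {t : BinaryTree ℕ | labels t = L}).Finite := by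
    refine Set.Finite.biUnion ?_ fun L _ => key L
    refine (List.finite_toSet (List.range' 1 (2 * n)).permutations).subset ?_
    intro L hL
    exact List.mem_permutations.2 hL
  refine hfin.subset ?_
  rintro t ⟨⟨⟨h, -⟩, -⟩, -⟩
  simp only [Set.mem_iUnion]
  exact ⟨labels t, h, rfl⟩

/-- Row sum `g_{2n}(m, •)` of an array indexed by `2 ≤ m ≤ 2n`, `1 ≤ k ≤ 2n - 1`. -/
def rowSum (g : ℕ → ℕ → ℕ → ℤ) (n m : ℕ) : ℤ := ∑ k ∈ Finset.Icc 1 (2 * n - 1), g n m k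

/-- Column sum `g_{2n}(•, k)`. -/
def colSum (g : ℕ → ℕ → ℕ → ℤ) (n k : ℕ) : ℤ := ∑ m ∈ Finset.Icc 2 (2 * n), g n m k

/-- Total sum `g_{2n}(•, •)`. -/
def totalSum (g : ℕ → ℕ → ℕ → ℤ) (n : ℕ) : ℤ :=
  ∑ m ∈ Finset.Icc 2 (2 * n), ∑ k ∈ Finset.Icc 1 (2 * n - 1), g n m k

/-- The secant number `E_{2n}`: the coefficient of `u ^ (2n) / (2n)!` in the Taylor expansion of
`sec u = 1 / cos u`. -/
noncomputable def secantNumber (n : ℕ) : ℚ :=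
  ((2 * n).factorial : ℚ) * PowerSeries.coeff (2 * n) (PowerSeries.cos ℚ)⁻¹

/-! ### The relations -/

/-- The finite difference equation systems inside the upper triangles. -/
structure DifferenceSystems (g : ℕ → ℕ → ℕ → ℤ) : Prop where
  /-- `Δ_m² g_{2n}(m,k) + 4 g_{2n-2}(m,k-2) = 0` for `2 ≤ m ≤ k-3 < k ≤ 2n-1`. -/
  R1 : ∀ n m k, 2 ≤ n → 2 ≤ m → m + 3 ≤ k → k ≤ 2 * n - 1 →
    fwdDiff 1 (fwdDiff 1 fun i => g n i k) m + 4 * g (n - 1) m (k - 2) = 0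
  /-- `Δ_k² g_{2n}(m,k) + 4 g_{2n-2}(m,k) = 0` for `2 ≤ m ≤ k-1 < k ≤ 2n-3`. -/
  R2 : ∀ n m k, 2 ≤ n → 2 ≤ m → m + 1 ≤ k → k ≤ 2 * n - 3 →
    fwdDiff 1 (fwdDiff 1 fun j => g n m j) k + 4 * g (n - 1) m k = 0

/-- The values on the first two rows and on the last two columns of the upper triangles. -/
structure BorderValues (g : ℕ → ℕ → ℕ → ℤ) : Prop where
  firstRow : ∀ n k, 2 ≤ n → 3 ≤ k → k ≤ 2 * n - 1 →
    g n 2 k = colSum g (n - 1) (k - 2) ∧ colSum g (n - 1) (k - 2) = rowSum g (n - 1) (k - 1)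
  secondRow : ∀ n k, 2 ≤ n → 4 ≤ k → k ≤ 2 * n - 1 → g n 3 k = 3 * g n 2 k
  lastCol : ∀ n m, 2 ≤ n → 2 ≤ m → m ≤ 2 * n - 2 →
    g n m (2 * n - 1) = rowSum g (n - 1) m ∧ rowSum g (n - 1) m = colSum g (n - 1) (m - 1)
  nextToLastCol : ∀ n m, 2 ≤ n → 2 ≤ m → m ≤ 2 * n - 3 →
    g n m (2 * n - 2) = 3 * g n m (2 * n - 1)

/-- The relations for the row and column sums. -/
structure SumRelations (g : ℕ → ℕ → ℕ → ℤ) : Prop where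
  col_one_init : colSum g 1 1 = 1
  col_one : ∀ n, 2 ≤ n →
    colSum g n 1 = totalSum g (n - 1) ∧ (totalSum g (n - 1) : ℚ) = secantNumber (n - 1)
  col_two : ∀ n, 2 ≤ n → colSum g n 2 = 3 * totalSum g (n - 1)
  R3 : ∀ n m, 2 ≤ n → 2 ≤ m → m ≤ 2 * n - 2 →
    fwdDiff 1 (fwdDiff 1 (rowSum g n)) m + 4 * rowSum g (n - 1) m = 0
  R4 : ∀ n k, 2 ≤ n → 1 ≤ k → k ≤ 2 * n - 3 →
    fwdDiff 1 (fwdDiff 1 (colSum g n)) k + 4 * colSum g (n - 1) k = 0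

/-! ### The algorithm -/

/-- The sequence `x` with `x 0 = b₀`, `x 1 = b₁` and `Δ² x + 4 q = 0`, computed step by step. -/
def propagate (b₀ b₁ : ℤ) (q : ℕ → ℤ) : ℕ → ℤ
  | 0 => b₀
  | 1 => b₁
  | i + 2 => 2 * propagate b₀ b₁ q (i + 1) - propagate b₀ b₁ q i - 4 * q i

/-- What the algorithm computes for a given size `2n`: the row sums `row m` (`2 ≤ m ≤ 2n`), the
column sums `col k` (`1 ≤ k ≤ 2n - 1`) and the entries `upper m k` of the upper triangle
(`2 ≤ m < k ≤ 2n - 1`). Values outside these ranges are never used. -/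
structure Level where
  row : ℕ → ℤ
  col : ℕ → ℤ
  upper : ℕ → ℕ → ℤ

/-- The relation used for the row and column sums. -/
inductive SumRule
  | R3
  | R4

/-- The relation used inside the upper triangle. -/
inductive EntryRule
  | R1
  | R2

/-- Size `2`: the only row sum and the only column sum are `1`, the upper triangle is empty. -/
def firstLevel : Level where
  row _ := 1
  col _ := 1
  upper _ _ := 0

/-- The total sum of the matrix of size `2n`, from its column sums. -/
def Level.total (n : ℕ) (p : Level) : ℤ := ∑ k ∈ Finset.Icc 1 (2 * n - 1), p.col k

/-- The row sums of size `2n + 2` from the data `p` of size `2n`: with rule `R3`, start from the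
rows `m = 2` and `m = 3` and go down; with rule `R4`, transfer the column sums. -/
def nextRow (s : SumRule) (n : ℕ) (p : Level) (m : ℕ) : ℤ :=
  match s with
  | .R3 => propagate (p.total n) (3 * p.total n) (fun i => p.row (i + 2)) (m - 2)
  | .R4 => propagate (p.total n) (3 * p.total n) (fun i => p.col (i + 1)) (m - 2)

/-- The column sums of size `2n + 2` from the data `p` of size `2n`: with rule `R4`, start from the
columns `k = 1` and `k = 2` and go to the right; with rule `R3`, transfer the row sums. -/
def nextCol (s : SumRule) (n : ℕ) (p : Level) (k : ℕ) : ℤ :=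
  match s with
  | .R3 => propagate (p.total n) (3 * p.total n) (fun i => p.row (i + 2)) (k - 1)
  | .R4 => propagate (p.total n) (3 * p.total n) (fun i => p.col (i + 1)) (k - 1)

/-- The upper triangle of size `2n + 2` from the data `p` of size `2n`: with rule `R1`, start from
the rows `m = 2` and `m = 3` and go down; with rule `R2`, start from the columns `k = 2n + 1` and
`k = 2n` and go to the left. -/
def nextUpper (e : EntryRule) (n : ℕ) (p : Level) (m k : ℕ) : ℤ :=
  match e with
  | .R1 => propagate (p.col (k - 2)) (3 * p.col (k - 2)) (fun i => p.upper (i + 2) (k - 2)) (m - 2)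
  | .R2 => propagate (p.row m) (3 * p.row m) (fun i => p.upper m (2 * n - 1 - i)) (2 * n + 1 - k)

/-- One step of the recursion, from size `2n` to size `2n + 2`. -/
def nextLevel (s : SumRule) (e : EntryRule) (n : ℕ) (p : Level) : Level where
  row := nextRow s n p
  col := nextCol s n p
  upper := nextUpper e n p

/-- The algorithm: `algorithm s e n` is the data of size `2n`, for `n ≥ 1`, obtained recursively
from size `2` with the chosen rules. (The value at `n = 0` is irrelevant.) -/
def algorithm (s : SumRule) (e : EntryRule) : ℕ → Level
  | 0 => firstLevel
  | 1 => firstLevel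
  | n + 2 => nextLevel s e (n + 1) (algorithm s e (n + 1))

/-- The level `p` consists of the row sums, the column sums and the upper triangle of the array
`g` for the size `2n`. -/
structure Level.Computes (p : Level) (g : ℕ → ℕ → ℕ → ℤ) (n : ℕ) : Prop where
  row_eq : ∀ m, 2 ≤ m → m ≤ 2 * n → p.row m = rowSum g n m
  col_eq : ∀ k, 1 ≤ k → k ≤ 2 * n - 1 → p.col k = colSum g n k
  upper_eq : ∀ m k, 2 ≤ m → m < k → k ≤ 2 * n - 1 → p.upper m k = g n m k

end SecantTree

/-! A tree is assembled by placing the labels in increasing order on open slots. A leaf closes its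
slot; a node with children replaces its slot by two. One slot, named `0`, is the rightmost one: it
never receives a leaf and stays empty at the end. The number of completions depends only on the
number `a` of the other open slots: a leaf can go to `a` of them, a node with children to all `a +
1` slots. This gives the operator T = `transfer`, with (T φ)(a) = a φ(a-1) + (a+1) φ(a+1), and the
trees of size 2n are counted by (T^(2n) vac)(0), where vac = `vacuum`.

For pom = k, the node k must have children and one of its child slots must be reserved for the leaf
2n. There are two choices on each ordinary slot and one on slot `0`, and the number of open slots
does not change. Hence a factor W = `weight`, the multiplication by 2a + 1 (`encard_forestParent`).

For eoc = m, follow the pair of slots below the current node of the minimal chain: the first label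
put on either of them continues the chain. The pair contains slot `0` until the chain leaves the
rightmost path, and then never again. This yields the operator `chainOp`. The key point is
`chainOp_zero`: evaluated at a = 0, `chainOp d` equals T^d W, because both satisfy the same second
order relation and the same initial values. This explains why eoc - 1 and pom have the same
distribution.

If m < k, the chain is finished before k is placed, and so f(m,k) = (T^p W T^q W T^s vac)(0) with p
= m-2, q = k-m-1, s = 2n-1-k. The row and column sums have the form (T^p W T^s vac)(0). All
difference equations are instances of T²W - 2TWT + WT² = -4W (`transfer_weight_relation`). The
border values come from W being 1 at a = 0 and 3 at a = 1, the secant numbers from T acting as d/du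
on sec u tan^a u.

For the algorithm, each relation is a second order recurrence with known right-hand side and two
known initial values (`propagate_eq`), so induction on n applies to any solution g of the relations.
-/

namespace SecantTree

open BinaryTree

/-! ### Transfer operators -/

/-- The transfer operator of alternating permutations. -/
def transfer : Module.End ℕ (ℕ → ℕ) where
  toFun φ a := a * φ (a - 1) + (a + 1) * φ (a + 1)
  map_add' φ ψ := by ext a; simp only [Pi.add_apply]; ring
  map_smul' c φ := by ext a; simp only [Pi.smul_apply, smul_eq_mul, RingHom.id_apply]; ring

/-- The transfer operator conjugated by the insertion of two more slots. -/
def transferThree : Module.End ℕ (ℕ → ℕ) where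
  toFun φ a := a * φ (a - 1) + (a + 3) * φ (a + 1)
  map_add' φ ψ := by ext a; simp only [Pi.add_apply]; ring
  map_smul' c φ := by ext a; simp only [Pi.smul_apply, smul_eq_mul, RingHom.id_apply]; ring

/-- The weight operator, with eigenvalues `2 * a + 1`. -/
def weight : Module.End ℕ (ℕ → ℕ) where
  toFun φ a := (2 * a + 1) * φ a
  map_add' φ ψ := by ext a; simp only [Pi.add_apply]; ring
  map_smul' c φ := by ext a; simp only [Pi.smul_apply, smul_eq_mul, RingHom.id_apply]; ring

/-- Twice the shift operator. -/
def twoShift : Module.End ℕ (ℕ → ℕ) where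
  toFun φ a := 2 * φ (a + 1)
  map_add' φ ψ := by ext a; simp only [Pi.add_apply]; ring
  map_smul' c φ := by ext a; simp only [Pi.smul_apply, smul_eq_mul, RingHom.id_apply]; ring

/-- The indicator function of `0`. -/
def vacuum : ℕ → ℕ := fun a => if a = 0 then 1 else 0

theorem transfer_apply (φ : ℕ → ℕ) (a : ℕ) :
    transfer φ a = a * φ (a - 1) + (a + 1) * φ (a + 1) := rfl

theorem transferThree_apply (φ : ℕ → ℕ) (a : ℕ) :
    transferThree φ a = a * φ (a - 1) + (a + 3) * φ (a + 1) := rfl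

theorem weight_apply (φ : ℕ → ℕ) (a : ℕ) : weight φ a = (2 * a + 1) * φ a := rfl

theorem twoShift_apply (φ : ℕ → ℕ) (a : ℕ) : twoShift φ a = 2 * φ (a + 1) := rfl

/-- The double commutator of `transfer` with `weight` is -4 `weight`, written without subtraction.
The eigenvalue 2a + 1 is affine in a, so the steps from a to a ± 2 cancel; the returns to a
contribute 4a² - 4(a+1)² = -4(2a+1). -/
theorem transfer_weight_relation :
    transfer * transfer * weight + weight * transfer * transfer + 4 * weight =
      2 * (transfer * weight * transfer) := by
  refine LinearMap.ext fun φ => funext fun a => ?_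
  have h4 : ∀ ψ : ℕ → ℕ, (4 : Module.End ℕ (ℕ → ℕ)) ψ = 4 • ψ := fun ψ => rfl
  have h2 : ∀ ψ : ℕ → ℕ, (2 : Module.End ℕ (ℕ → ℕ)) ψ = 2 • ψ := fun ψ => rfl
  simp only [LinearMap.add_apply, Module.End.mul_apply, h4, h2, Pi.add_apply, Pi.smul_apply,
    transfer_apply, weight_apply, smul_eq_mul]
  -- The cases a = 0 and a = 1 are those where a truncated subtraction occurs; the coefficient of
  -- that term is zero.
  rcases a with _ | _ | a <;> simp <;> ring

theorem transferThree_twoShift :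
    transferThree * twoShift + transfer * twoShift + 4 = 2 * (twoShift * transfer) := by
  refine LinearMap.ext fun φ => funext fun a => ?_
  have h4 : ∀ ψ : ℕ → ℕ, (4 : Module.End ℕ (ℕ → ℕ)) ψ = 4 • ψ := fun ψ => rfl
  have h2 : ∀ ψ : ℕ → ℕ, (2 : Module.End ℕ (ℕ → ℕ)) ψ = 2 • ψ := fun ψ => rfl
  simp only [LinearMap.add_apply, Module.End.mul_apply, h4, h2, Pi.add_apply, Pi.smul_apply,
    transfer_apply, transferThree_apply, twoShift_apply, smul_eq_mul]
  rcases a with _ | _ | a <;> simp <;> ring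

theorem transferThree_sq_twoShift :
    transferThree * transferThree * twoShift + twoShift * transfer * transfer + 4 * twoShift =
      2 * (transferThree * twoShift * transfer) := by
  refine LinearMap.ext fun φ => funext fun a => ?_
  have h4 : ∀ ψ : ℕ → ℕ, (4 : Module.End ℕ (ℕ → ℕ)) ψ = 4 • ψ := fun ψ => rfl
  have h2 : ∀ ψ : ℕ → ℕ, (2 : Module.End ℕ (ℕ → ℕ)) ψ = 2 • ψ := fun ψ => rfl
  simp only [LinearMap.add_apply, Module.End.mul_apply, h4, h2, Pi.add_apply, Pi.smul_apply,
    transfer_apply, transferThree_apply, twoShift_apply, smul_eq_mul]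
  rcases a with _ | _ | a <;> simp <;> ring

/-- The sum of the products of powers of `transfer` and `transferThree` of total degree `d - 1`. -/
def mixed : ℕ → Module.End ℕ (ℕ → ℕ)
  | 0 => 0
  | d + 1 => transfer * mixed d + transferThree ^ d

/-- The definition peels off a factor on the left; the relations with `twoShift` need one on the
right. -/
theorem mixed_succ (d : ℕ) : mixed (d + 1) = mixed d * transferThree + transfer ^ d := by
  induction d with
  | zero => simp [mixed]
  | succ d ih =>
    rw [mixed, ih, mul_add, ← pow_succ', add_right_comm]
    conv_rhs => rw [← ih, mixed]
    rw [add_mul, mul_assoc, pow_succ transferThree]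

/-- The operator that counts the minimal chains with `d` more labels to place. -/
def chainOp (d : ℕ) : Module.End ℕ (ℕ → ℕ) := transfer ^ d + mixed d * twoShift

/-- This is the form in which the count of chains produces the operator: the chain either stays on
the rightmost path or leaves it at this label. -/
theorem chainOp_succ (d : ℕ) :
    chainOp (d + 1) = transfer * chainOp d + transferThree ^ d * twoShift := by
  simp only [chainOp, mixed, pow_succ']
  noncomm_ring

/-- The relation of `transfer_pow_weight_relation` with `chainOp d` in place of T^d W. It is the sum
of `transferThree_twoShift` multiplied on the left by T^d and `transferThree_sq_twoShift` multiplied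
on the left by `mixed d`. -/
theorem chainOp_relation (d : ℕ) :
    chainOp (d + 2) + chainOp d * transfer * transfer + 4 * chainOp d =
      2 * (chainOp (d + 1) * transfer) := by
  have e1 := congrArg (fun x => transfer ^ d * x) transferThree_twoShift
  have e2 := congrArg (fun x => mixed d * x) transferThree_sq_twoShift
  simp only [chainOp, mixed_succ, pow_succ] at e1 e2 ⊢
  have c4 : ∀ x : Module.End ℕ (ℕ → ℕ), (4 : Module.End ℕ (ℕ → ℕ)) * x = 4 • x := fun x => by
    rw [nsmul_eq_mul]; rfl
  have c4' : ∀ x : Module.End ℕ (ℕ → ℕ), x * (4 : Module.End ℕ (ℕ → ℕ)) = 4 • x := fun x => by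
    rw [nsmul_eq_mul']; rfl
  have c2 : ∀ x : Module.End ℕ (ℕ → ℕ), (2 : Module.End ℕ (ℕ → ℕ)) * x = 2 • x := fun x => by
    rw [nsmul_eq_mul]; rfl
  simp only [c4, c4', c2, mul_add, add_mul, ← mul_assoc, smul_add, mul_smul_comm] at e1 e2 ⊢
  calc _ = (transfer ^ d * transfer * transfer + transfer ^ d * transfer * transfer) +
      (transfer ^ d * transferThree * twoShift + transfer ^ d * transfer * twoShift
        + 4 • transfer ^ d) + (mixed d * transferThree * transferThree * twoShift +
        mixed d * twoShift * transfer * transfer + 4 • (mixed d * twoShift)) := by abel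
    _ = _ := by rw [e1, e2]; abel

theorem transfer_pow_weight_relation (d : ℕ) (φ : ℕ → ℕ) (b : ℕ) :
    (transfer ^ (d + 2)) (weight φ) b + (transfer ^ d) (weight (transfer (transfer φ))) b +
      4 * (transfer ^ d) (weight φ) b = 2 * (transfer ^ (d + 1)) (weight (transfer φ)) b := by
  have h := congrFun (congrArg (fun x : Module.End ℕ (ℕ → ℕ) => (transfer ^ d) (x φ))
    transfer_weight_relation) b
  have h4 : ∀ ψ : ℕ → ℕ, (4 : Module.End ℕ (ℕ → ℕ)) ψ = 4 • ψ := fun ψ => rfl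
  have h2 : ∀ ψ : ℕ → ℕ, (2 : Module.End ℕ (ℕ → ℕ)) ψ = 2 • ψ := fun ψ => rfl
  simp only [LinearMap.add_apply, Module.End.mul_apply, h4, h2, map_add, map_nsmul, Pi.add_apply,
    Pi.smul_apply, smul_eq_mul] at h
  simpa only [pow_succ, Module.End.mul_apply] using h

/-- Two-step induction on d for all φ at once: both sides satisfy the same relation, whose other
terms involve d and d + 1 applied to φ, T φ and T² φ. At a = 0 the initial values are φ(0) and 3
φ(1) on both sides. -/
theorem chainOp_zero (d : ℕ) (φ : ℕ → ℕ) : chainOp d φ 0 = (transfer ^ d) (weight φ) 0 := by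
  suffices h : ∀ φ, chainOp d φ 0 = (transfer ^ d) (weight φ) 0 ∧
      chainOp (d + 1) φ 0 = (transfer ^ (d + 1)) (weight φ) 0 from (h φ).1
  induction d with
  | zero =>
    intro φ
    simp [chainOp, mixed, weight_apply, transfer_apply, twoShift_apply]
    ring
  | succ d ih =>
    intro φ
    refine ⟨(ih φ).2, ?_⟩
    have h1 := transfer_pow_weight_relation d φ 0
    have h := congrFun (congrArg (fun x : Module.End ℕ (ℕ → ℕ) => x φ) (chainOp_relation d)) 0
    have h4 : ∀ ψ : ℕ → ℕ, (4 : Module.End ℕ (ℕ → ℕ)) ψ = 4 • ψ := fun ψ => rfl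
    have h2 : ∀ ψ : ℕ → ℕ, (2 : Module.End ℕ (ℕ → ℕ)) ψ = 2 • ψ := fun ψ => rfl
    simp only [LinearMap.add_apply, Module.End.mul_apply, h4, h2, Pi.add_apply, Pi.smul_apply,
      smul_eq_mul, (ih _).1, (ih _).2] at h
    change chainOp (d + 2) φ 0 = (transfer ^ (d + 2)) (weight φ) 0
    omega

/-! ### Secant numbers -/

open PowerSeries in
theorem derivative_sin_rat : derivative ℚ (PowerSeries.sin ℚ) = PowerSeries.cos ℚ := by
  ext n
  rw [coeff_derivative]
  rcases Nat.even_or_odd n with h | h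
  · have h' : ¬ Even (n + 1) := by simpa [Nat.even_add_one] using h
    have e : (n + 1) / 2 = n / 2 := by obtain ⟨r, rfl⟩ := h; omega
    simp [PowerSeries.sin, PowerSeries.cos, h, h', Nat.factorial_succ, e]
    have : ((n:ℚ) + 1) ≠ 0 := by positivity
    field_simp
  · have h' : Even (n + 1) := by simpa [Nat.even_add_one] using h
    simp [PowerSeries.sin, PowerSeries.cos, h', Nat.not_even_iff_odd.2 h]

open PowerSeries in
theorem derivative_cos_rat : derivative ℚ (PowerSeries.cos ℚ) = -PowerSeries.sin ℚ := by
  ext n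
  rw [coeff_derivative]
  rcases Nat.even_or_odd n with h | h
  · have h' : ¬ Even (n + 1) := by simpa [Nat.even_add_one] using h
    simp [PowerSeries.sin, PowerSeries.cos, h, h']
  · have h' : Even (n + 1) := by simpa [Nat.even_add_one] using h
    have e : (n + 1) / 2 = n / 2 + 1 := by obtain ⟨r, rfl⟩ := h; omega
    simp [PowerSeries.sin, PowerSeries.cos, h', Nat.not_even_iff_odd.2 h, Nat.factorial_succ, e,
      pow_succ]
    have : ((n:ℚ) + 1) ≠ 0 := by positivity
    field_simp

-- The derivative of sec u tan^a u is a sec u tan^(a-1) u + (a+1) sec u tan^(a+1) u, which is the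
-- action of `transfer` on the index a.
open PowerSeries in
theorem transfer_pow_vacuum_eq_coeff (j a : ℕ) :
    ((transfer ^ j) vacuum a : ℚ) = j.factorial *
      PowerSeries.coeff j ((PowerSeries.cos ℚ)⁻¹ * (PowerSeries.sin ℚ * (PowerSeries.cos ℚ)⁻¹) ^ a)
      := by
  have hc : constantCoeff (PowerSeries.cos ℚ) = 1 := by
    rw [← coeff_zero_eq_constantCoeff_apply]; simp [PowerSeries.cos]
  have hs : constantCoeff (PowerSeries.sin ℚ) = 0 := by
    rw [← coeff_zero_eq_constantCoeff_apply]; simp [PowerSeries.sin]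
  have hcc : PowerSeries.cos ℚ * (PowerSeries.cos ℚ)⁻¹ = 1 :=
    PowerSeries.mul_inv_cancel _ (by rw [hc]; exact one_ne_zero)
  induction j generalizing a with
  | zero =>
    rcases a with _ | a <;> simp [vacuum, hc, hs]
  | succ j ih =>
    rw [pow_succ', Module.End.mul_apply, transfer_apply]
    push_cast
    rw [ih, ih]
    have hd : derivative ℚ ((PowerSeries.cos ℚ)⁻¹ *
        (PowerSeries.sin ℚ * (PowerSeries.cos ℚ)⁻¹) ^ a) =
        C (a : ℚ) * ((PowerSeries.cos ℚ)⁻¹ *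
          (PowerSeries.sin ℚ * (PowerSeries.cos ℚ)⁻¹) ^ (a - 1)) +
        C ((a : ℚ) + 1) * ((PowerSeries.cos ℚ)⁻¹ *
          (PowerSeries.sin ℚ * (PowerSeries.cos ℚ)⁻¹) ^ (a + 1)) := by
      have h1 : derivative ℚ ((PowerSeries.cos ℚ)⁻¹) =
          (PowerSeries.cos ℚ)⁻¹ * (PowerSeries.sin ℚ * (PowerSeries.cos ℚ)⁻¹) := by
        rw [derivative_inv', derivative_cos_rat]; ring
      have h2 : derivative ℚ (PowerSeries.sin ℚ * (PowerSeries.cos ℚ)⁻¹) =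
          1 + (PowerSeries.sin ℚ * (PowerSeries.cos ℚ)⁻¹) ^ 2 := by
        rw [Derivation.leibniz, h1, derivative_sin_rat, smul_eq_mul, smul_eq_mul,
          mul_comm _ (PowerSeries.cos ℚ), hcc]
        ring
      rw [Derivation.leibniz, derivative_pow, h1, h2, smul_eq_mul, smul_eq_mul]
      simp only [map_add, map_natCast, map_one]
      rcases a with _ | a
      · simp
      · simp only [Nat.add_sub_cancel]
        push_cast
        ring
    have := congrArg (coeff j) hd
    rw [coeff_derivative, map_add, coeff_C_mul, coeff_C_mul] at this
    rw [Nat.factorial_succ]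
    push_cast
    linear_combination (-(j.factorial : ℚ)) * this

theorem transfer_pow_eq_secantNumber (n : ℕ) :
    ((transfer ^ (2 * n)) vacuum 0 : ℚ) = secantNumber n := by
  rw [transfer_pow_vacuum_eq_coeff, secantNumber, pow_zero, mul_one]

/-! ### Increasing trees -/

theorem rootLabel_mem_labels {t : BinaryTree ℕ} {a : ℕ} (h : rootLabel t = some a) :
    a ∈ labels t := by
  cases t with
  | nil => simp [rootLabel] at h
  | node b l r =>
    simp only [rootLabel, Option.some.injEq] at h
    simp [labels, h]

theorem labels_eq_nil {t : BinaryTree ℕ} : labels t = [] ↔ t = nil := by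
  cases t <;> simp [labels]

/-- All labels are at least the label of the root. -/
theorem LabelsIncrease.root_le {t : BinaryTree ℕ} (h : LabelsIncrease t) {a : ℕ}
    (ha : rootLabel t = some a) : ∀ b ∈ labels t, a ≤ b := by
  induction t generalizing a with
  | nil => simp [labels]
  | node c l r ihl ihr =>
    obtain ⟨hl, hr, il, ir⟩ := h
    simp only [rootLabel, Option.some.injEq] at ha
    subst ha
    have key : ∀ s : BinaryTree ℕ, (∀ b ∈ rootLabel s, c < b) →
        (∀ {a}, rootLabel s = some a → ∀ b ∈ labels s, a ≤ b) → ∀ b ∈ labels s, c ≤ b := by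
      intro s h1 h2 b hb
      cases s with
      | nil => simp [labels] at hb
      | node d l r => exact (h1 d rfl).le.trans (h2 rfl b hb)
    intro b hb
    simp only [labels, List.mem_append, List.mem_cons] at hb
    rcases hb with hb | rfl | hb
    · exact key l hl (ihl il) b hb
    · exact le_rfl
    · exact key r hr (ihr ir) b hb

theorem labelsIncrease_node {a : ℕ} {l r : BinaryTree ℕ} :
    LabelsIncrease (node a l r) ↔ (∀ b ∈ labels l, a < b) ∧ (∀ b ∈ labels r, a < b) ∧
      LabelsIncrease l ∧ LabelsIncrease r := by
  have key : ∀ s : BinaryTree ℕ, LabelsIncrease s →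
      ((∀ b ∈ rootLabel s, a < b) ↔ ∀ b ∈ labels s, a < b) := by
    intro s hs
    refine ⟨fun h b hb => ?_, fun h b hb => h b (rootLabel_mem_labels hb)⟩
    cases s with
    | nil => simp [labels] at hb
    | node d l r => exact (h d rfl).trans_le (hs.root_le rfl b hb)
  constructor
  · rintro ⟨h1, h2, h3, h4⟩
    exact ⟨(key l h3).1 h1, (key r h4).1 h2, h3, h4⟩
  · rintro ⟨h1, h2, h3, h4⟩
    exact ⟨(key l h3).2 h1, (key r h4).2 h2, h3, h4⟩

/-- The root carries the smallest label. -/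
theorem LabelsIncrease.rootLabel_of_min {t : BinaryTree ℕ} (h : LabelsIncrease t) {j : ℕ}
    (hj : j ∈ labels t) (hmin : ∀ b ∈ labels t, j ≤ b) : rootLabel t = some j := by
  cases t with
  | nil => simp [labels] at hj
  | node a l r =>
    have h1 := h.root_le rfl j hj
    have h2 := hmin a (by simp [labels])
    simp [rootLabel, le_antisymm h1 h2]

/-- A tree that can hang at the rightmost slot: the empty tree, or a tree in which every node is a
leaf or has two children except the rightmost node, which only has a left child. -/
def IsRightmost : BinaryTree ℕ → Prop
  | nil => True
  | node _ l r => l ≠ nil ∧ LeafOrTwoChildren l ∧ IsRightmost r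

theorem hasOneChildRightmost_iff {t : BinaryTree ℕ} :
    HasOneChildRightmost t ↔ t ≠ nil ∧ IsRightmost t := by
  induction t with
  | nil => simp [HasOneChildRightmost]
  | node a l r _ ihr =>
    cases r with
    | nil => simp [HasOneChildRightmost, IsRightmost]
    | node b l' r' => simp [HasOneChildRightmost, ihr, IsRightmost]

/-! ### The parent of a label -/

/-- Some node labelled `k` has a child labelled `j`. -/
def HasParent (k j : ℕ) : BinaryTree ℕ → Prop
  | nil => False
  | node a l r =>
      (a = k ∧ (rootLabel l = some j ∨ rootLabel r = some j)) ∨ HasParent k j l ∨ HasParent k j r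

theorem HasParent.parent_mem {k j : ℕ} {t : BinaryTree ℕ} (h : HasParent k j t) :
    k ∈ labels t := by
  induction t with
  | nil => exact h.elim
  | node a l r ihl ihr =>
    simp only [labels, List.mem_append, List.mem_cons]
    rcases h with ⟨rfl, -⟩ | h | h
    · simp
    · exact Or.inl (ihl h)
    · exact Or.inr (Or.inr (ihr h))

theorem HasParent.child_mem {k j : ℕ} {t : BinaryTree ℕ} (h : HasParent k j t) :
    j ∈ labels t := by
  induction t with
  | nil => exact h.elim
  | node a l r ihl ihr =>
    simp only [labels, List.mem_append, List.mem_cons]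
    rcases h with ⟨-, h | h⟩ | h | h
    · exact Or.inl (rootLabel_mem_labels h)
    · exact Or.inr (Or.inr (rootLabel_mem_labels h))
    · exact Or.inl (ihl h)
    · exact Or.inr (Or.inr (ihr h))

theorem HasParent.parent_lt {k j : ℕ} {t : BinaryTree ℕ} (h : HasParent k j t)
    (ht : LabelsIncrease t) : k < j := by
  induction t with
  | nil => exact h.elim
  | node a l r ihl ihr =>
    obtain ⟨hl, hr, il, ir⟩ := ht
    rcases h with ⟨rfl, h | h⟩ | h | h
    · exact hl _ h
    · exact hr _ h
    · exact ihl h il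
    · exact ihr h ir

theorem HasParent.root_ne {k j : ℕ} {t : BinaryTree ℕ} (h : HasParent k j t)
    (ht : LabelsIncrease t) : rootLabel t ≠ some j := by
  intro hr
  exact absurd (ht.root_le hr k h.parent_mem) (not_le.2 (h.parent_lt ht))

theorem mem_labels_of_parentLabel {j : ℕ} {t : BinaryTree ℕ} (h : (parentLabel j t).isSome) :
    j ∈ labels t := by
  induction t with
  | nil => simp [parentLabel] at h
  | node b u v ihu ihv =>
    rw [parentLabel] at h
    split_ifs at h with hs
    · rcases hs with hs | hs
      · simp [labels, rootLabel_mem_labels hs]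
      · simp [labels, rootLabel_mem_labels hs]
    · rcases hu : parentLabel j u with _ | w
      · simp only [hu, Option.orElse_none] at h
        simp [labels, ihv h]
      · simp [labels, ihu (by simp [hu])]

/-- Since the labels are distinct, the order of the search in `parentLabel` is irrelevant. The
relation `HasParent` is easier to follow when trees are joined. -/
theorem parentLabel_eq_some_iff {k j : ℕ} {t : BinaryTree ℕ} (ht : LabelsIncrease t)
    (hd : (labels t).Nodup) : parentLabel j t = some k ↔ HasParent k j t := by
  induction t with
  | nil => simp [parentLabel, HasParent]
  | node a l r ihl ihr =>
    have ht' := ht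
    obtain ⟨-, -, il, ir⟩ := ht
    simp only [labels, List.nodup_append, List.nodup_cons, List.mem_cons] at hd
    obtain ⟨dl, ⟨-, dr⟩, hlr⟩ := hd
    have hdisj : j ∈ labels l → j ∉ labels r := fun h1 h2 => hlr j h1 j (Or.inr h2) rfl
    specialize ihl il dl
    specialize ihr ir dr
    rw [parentLabel, HasParent]
    split_ifs with hc
    · have nl : ¬ HasParent k j l := by
        intro h
        rcases hc with hc | hc
        · exact h.root_ne il hc
        · exact hdisj h.child_mem (rootLabel_mem_labels hc)
      have nr : ¬ HasParent k j r := by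
        intro h
        rcases hc with hc | hc
        · exact hdisj (rootLabel_mem_labels hc) h.child_mem
        · exact h.root_ne ir hc
      simp [hc, nl, nr]
    · simp only [hc, and_false, false_or]
      rw [← ihl, ← ihr]
      rcases hp : parentLabel j l with _ | k'
      · simp
      · have nr : parentLabel j r ≠ some k := by
          rw [Ne, ihr]
          intro h
          exact hdisj (mem_labels_of_parentLabel (by simp [hp])) h.child_mem
        simp [nr]

/-- A label is the label of the root or the label of a child. -/
theorem exists_hasParent {j : ℕ} {t : BinaryTree ℕ} (h : j ∈ labels t) :
    rootLabel t = some j ∨ ∃ k, HasParent k j t := by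
  induction t with
  | nil => simp [labels] at h
  | node a l r ihl ihr =>
    simp only [labels, List.mem_append, List.mem_cons] at h
    rcases h with h | rfl | h
    · rcases ihl h with h' | ⟨k, hk⟩
      · exact Or.inr ⟨a, Or.inl ⟨rfl, Or.inl h'⟩⟩
      · exact Or.inr ⟨k, Or.inr (Or.inl hk)⟩
    · exact Or.inl rfl
    · rcases ihr h with h' | ⟨k, hk⟩
      · exact Or.inr ⟨a, Or.inl ⟨rfl, Or.inr h'⟩⟩
      · exact Or.inr ⟨k, Or.inr (Or.inr hk)⟩

/-! ### The minimal chain below a node -/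

/-- The end of the minimal chain that starts from a node with children `l` and `r`. -/
def chainEnd (l r : BinaryTree ℕ) : ℕ := eoc (node 0 l r)

theorem eoc_node {a : ℕ} {l r : BinaryTree ℕ} (h : l ≠ nil) :
    eoc (node a l r) = chainEnd l r := by
  cases l with
  | nil => exact absurd rfl h
  | node b u v => cases r <;> simp [chainEnd, eoc]

theorem chainEnd_eq_eoc_left {j : ℕ} {u v r : BinaryTree ℕ} (hr : ∀ b ∈ labels r, j < b) :
    chainEnd (node j u v) r = eoc (node j u v) := by
  cases r with
  | nil => simp [chainEnd, eoc]
  | node c l' r' =>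
    have : j < c := hr c (by simp [labels])
    simp [chainEnd, eoc, this]

theorem chainEnd_eq_eoc_right {j : ℕ} {u v l : BinaryTree ℕ} (hl : ∀ b ∈ labels l, j < b) :
    chainEnd l (node j u v) = eoc (node j u v) := by
  cases l with
  | nil => simp [chainEnd, eoc]
  | node c l' r' =>
    have : j < c := hl c (by simp [labels])
    simp [chainEnd, eoc, this.le]

theorem eoc_mem_labels {t : BinaryTree ℕ} (h : t ≠ nil) : eoc t ∈ labels t := by
  fun_induction eoc t with
  | case1 => exact absurd rfl h
  | case2 => simp [labels]
  | case3 a b l r ih =>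
    have := ih (by simp)
    rw [labels]; exact List.mem_append_left _ this
  | case4 a c l r ih =>
    have := ih (by simp)
    rw [labels]; exact List.mem_append_right _ (List.mem_cons_of_mem _ this)
  | case5 a b l r c l' r' hlt ih =>
    have := ih (by simp)
    rw [labels]; exact List.mem_append_left _ this
  | case6 a b l r c l' r' hlt ih =>
    have := ih (by simp)
    rw [labels]; exact List.mem_append_right _ (List.mem_cons_of_mem _ this)

theorem chainEnd_mem_labels {l r : BinaryTree ℕ} (h : l ≠ nil) :
    chainEnd l r ∈ labels l ∨ chainEnd l r ∈ labels r := by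
  cases l with
  | nil => exact absurd rfl h
  | node b u v =>
    cases r with
    | nil =>
      refine Or.inl ?_
      simpa [chainEnd, eoc] using eoc_mem_labels (t := node b u v) (by simp)
    | node c u' v' =>
      rw [chainEnd, eoc]
      split_ifs
      · exact Or.inl (eoc_mem_labels (by simp))
      · exact Or.inr (eoc_mem_labels (by simp))

/-! ### Forests -/

/-- `F` puts increasing trees on the slots in `B`, the labels being `j, …, M - 1`. The slot `0` is
the rightmost slot, the other ones carry nonempty trees in which every node is a leaf or has two
children. -/
structure IsForest (j M : ℕ) (B : Finset ℕ) (F : ℕ → BinaryTree ℕ) : Prop where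
  increase : ∀ i, LabelsIncrease (F i)
  full : ∀ i ∈ B, i ≠ 0 → F i ≠ nil ∧ LeafOrTwoChildren (F i)
  rightmost : IsRightmost (F 0)
  empty : ∀ i ∉ B, F i = nil
  labels_eq : ∑ i ∈ B, (labels (F i) : Multiset ℕ) = (Finset.Ico j M).val

/-- Put a leaf labelled `j` on the slot `i`. -/
def attachLeaf (j i : ℕ) (F : ℕ → BinaryTree ℕ) : ℕ → BinaryTree ℕ :=
  Function.update F i (node j nil nil)

/-- Join the trees on the slots `y` and `i` by a node labelled `j` on the slot `i`. -/
def attachFork (j i y : ℕ) (F : ℕ → BinaryTree ℕ) : ℕ → BinaryTree ℕ :=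
  Function.update (Function.update F y nil) i (node j (F y) (F i))

theorem attachLeaf_self (j i : ℕ) (F : ℕ → BinaryTree ℕ) :
    attachLeaf j i F i = node j nil nil := by simp [attachLeaf]

theorem attachLeaf_of_ne {j i z : ℕ} (F : ℕ → BinaryTree ℕ) (h : z ≠ i) :
    attachLeaf j i F z = F z := by simp [attachLeaf, h]

theorem attachFork_self (j i y : ℕ) (F : ℕ → BinaryTree ℕ) :
    attachFork j i y F i = node j (F y) (F i) := by simp [attachFork]

theorem attachFork_new {j i y : ℕ} (F : ℕ → BinaryTree ℕ) (h : y ≠ i) :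
    attachFork j i y F y = nil := by simp [attachFork, h]

theorem attachFork_of_ne {j i y z : ℕ} (F : ℕ → BinaryTree ℕ) (h : z ≠ i) (h' : z ≠ y) :
    attachFork j i y F z = F z := by simp [attachFork, h, h']

namespace IsForest

variable {j M : ℕ} {B : Finset ℕ} {F : ℕ → BinaryTree ℕ}

theorem mem_of_label (h : IsForest j M B F) {i b : ℕ} (hb : b ∈ labels (F i)) : i ∈ B := by
  by_contra hi
  rw [h.empty i hi] at hb
  simp [labels] at hb

theorem bounds (h : IsForest j M B F) {i b : ℕ} (hb : b ∈ labels (F i)) : j ≤ b ∧ b < M := by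
  have : b ∈ ∑ i ∈ B, (labels (F i) : Multiset ℕ) :=
    Multiset.mem_sum.2 ⟨i, h.mem_of_label hb, by simpa using hb⟩
  rw [h.labels_eq] at this
  simpa using this

theorem exists_slot (h : IsForest j M B F) {b : ℕ} (hj : j ≤ b) (hM : b < M) :
    ∃ i ∈ B, b ∈ labels (F i) := by
  have : b ∈ ∑ i ∈ B, (labels (F i) : Multiset ℕ) := by
    rw [h.labels_eq]; simp [hj, hM]
  obtain ⟨i, hi, hb⟩ := Multiset.mem_sum.1 this
  exact ⟨i, hi, by simpa using hb⟩

theorem slot_unique (h : IsForest j M B F) {i i' b : ℕ} (hb : b ∈ labels (F i))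
    (hb' : b ∈ labels (F i')) : i = i' := by
  by_contra hne
  have hn : (∑ i ∈ B, (labels (F i) : Multiset ℕ)).Nodup := by
    rw [h.labels_eq]; exact (Finset.Ico j M).nodup
  rw [← Finset.add_sum_erase _ _ (h.mem_of_label hb), Multiset.nodup_add] at hn
  refine (Multiset.disjoint_left.1 hn.2.2) (by simpa using hb) (Multiset.mem_sum.2 ⟨i', ?_, ?_⟩)
  · exact Finset.mem_erase.2 ⟨fun e => hne e.symm, h.mem_of_label hb'⟩
  · simpa using hb'

end IsForest

theorem Ico_val_eq_cons {j M : ℕ} (h : j < M) :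
    (Finset.Ico j M).val = j ::ₘ (Finset.Ico (j + 1) M).val := by
  rw [← Finset.insert_Ico_add_one_left_eq_Ico h, Finset.insert_val_of_notMem (by simp)]

/-- The label x may be either end of the interval: the smallest label is attached to build forests,
the largest one to reserve the slot of the maximum leaf. As `attachLeaf` overwrites `F i`, the
condition `F i = nil` is what makes the correspondence bijective. -/
theorem isForest_attachLeaf_iff {j M j' M' x i : ℕ} {B : Finset ℕ} {F : ℕ → BinaryTree ℕ}
    (hval : (Finset.Ico j M).val = x ::ₘ (Finset.Ico j' M').val) (hi : i ∈ B) (hi0 : i ≠ 0) :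
    IsForest j' M' (B.erase i) F ↔ IsForest j M B (attachLeaf x i F) ∧ F i = nil := by
  have hlab : ∑ z ∈ B, (labels (attachLeaf x i F z) : Multiset ℕ) =
      x ::ₘ ∑ z ∈ B.erase i, (labels (F z) : Multiset ℕ) := by
    rw [← Finset.add_sum_erase _ _ hi, attachLeaf_self]
    have : ∀ s : Multiset ℕ, ((labels (node x nil nil) : List ℕ) : Multiset ℕ) + s = x ::ₘ s :=
      fun s => by simp [labels]
    rw [this]
    congr 1
    refine Finset.sum_congr rfl fun z hz => ?_
    rw [attachLeaf_of_ne _ (Finset.ne_of_mem_erase hz)]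
  constructor
  · intro h
    refine ⟨⟨fun z => ?_, fun z hz hz0 => ?_, ?_, fun z hz => ?_, ?_⟩, h.empty i (by simp)⟩
    · by_cases e : z = i
      · subst e; rw [attachLeaf_self]; simp [LabelsIncrease, rootLabel]
      · rw [attachLeaf_of_ne _ e]; exact h.increase z
    · by_cases e : z = i
      · subst e; rw [attachLeaf_self]; simp [LeafOrTwoChildren]
      · rw [attachLeaf_of_ne _ e]; exact h.full z (by simp [e, hz]) hz0
    · rw [attachLeaf_of_ne _ hi0.symm]; exact h.rightmost
    · have e : z ≠ i := fun e => hz (e ▸ hi)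
      rw [attachLeaf_of_ne _ e]; exact h.empty z (by simp [hz])
    · rw [hlab, h.labels_eq, hval]
  · rintro ⟨h, hn⟩
    refine ⟨fun z => ?_, fun z hz hz0 => ?_, ?_, fun z hz => ?_, ?_⟩
    · by_cases e : z = i
      · subst e; rw [hn]; trivial
      · rw [← attachLeaf_of_ne (j := x) F e]; exact h.increase z
    · rw [← attachLeaf_of_ne (j := x) F (Finset.ne_of_mem_erase hz)]
      exact h.full z (Finset.mem_of_mem_erase hz) hz0
    · rw [← attachLeaf_of_ne (j := x) F hi0.symm]; exact h.rightmost
    · by_cases e : z = i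
      · subst e; exact hn
      · rw [← attachLeaf_of_ne (j := x) F e]; exact h.empty z fun hz' => hz (by simp [e, hz'])
    · have := h.labels_eq
      rwa [hlab, hval, Multiset.cons_inj_right] at this

/-- The new slot y carries the left subtree, and i keeps the right one; thus for i = 0 the rightmost
slot remains `0`, and its tree may be empty. The condition `F y ≠ nil` separates this case from a
leaf. -/
theorem isForest_attachFork_iff {j M i y : ℕ} {B : Finset ℕ} {F : ℕ → BinaryTree ℕ} (hj : j < M)
    (h0 : 0 ∈ B) (hi : i ∈ B) (hy : y ∉ B) :
    IsForest (j + 1) M (insert y B) F ↔ IsForest j M B (attachFork j i y F) ∧ F y ≠ nil := by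
  have hyi : y ≠ i := fun e => hy (e ▸ hi)
  have hy0 : y ≠ 0 := fun e => hy (e ▸ h0)
  have hlab : ∑ z ∈ B, (labels (attachFork j i y F z) : Multiset ℕ) =
      j ::ₘ ∑ z ∈ insert y B, (labels (F z) : Multiset ℕ) := by
    rw [Finset.sum_insert hy, ← Finset.add_sum_erase _ _ hi, attachFork_self,
      ← Finset.add_sum_erase _ (fun z => (labels (F z) : Multiset ℕ)) hi]
    have : ((labels (node j (F y) (F i)) : List ℕ) : Multiset ℕ) =
        j ::ₘ ((labels (F y) : Multiset ℕ) + (labels (F i) : Multiset ℕ)) := by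
      rw [labels, ← Multiset.coe_add, ← Multiset.cons_coe, Multiset.add_cons]
    rw [this, Multiset.cons_add, add_assoc]
    congr 3
    refine Finset.sum_congr rfl fun z hz => ?_
    rw [attachFork_of_ne _ (Finset.ne_of_mem_erase hz)
      fun e : z = y => hy (e ▸ Finset.mem_of_mem_erase hz)]
  constructor
  · intro h
    refine ⟨⟨fun z => ?_, fun z hz hz0 => ?_, ?_, fun z hz => ?_, ?_⟩, (h.full y (by simp) hy0).1⟩
    · by_cases e : z = i
      · subst e
        rw [attachFork_self, labelsIncrease_node]
        exact ⟨fun b hb => (h.bounds hb).1, fun b hb => (h.bounds hb).1, h.increase y,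
          h.increase z⟩
      · by_cases e' : z = y
        · subst e'; rw [attachFork_new _ e]; trivial
        · rw [attachFork_of_ne _ e e']; exact h.increase z
    · by_cases e : z = i
      · subst e
        rw [attachFork_self]
        have h1 := h.full z (by simp [hz]) hz0
        have h2 := h.full y (by simp) hy0
        exact ⟨by simp, by simp [h1.1, h2.1], h2.2, h1.2⟩
      · have e' : z ≠ y := fun e' => hy (e' ▸ hz)
        rw [attachFork_of_ne _ e e']; exact h.full z (by simp [hz]) hz0
    · by_cases e : 0 = i
      · subst e
        rw [attachFork_self]
        have h2 := h.full y (by simp) hy0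
        exact ⟨h2.1, h2.2, h.rightmost⟩
      · rw [attachFork_of_ne _ e hy0.symm]; exact h.rightmost
    · have e : z ≠ i := fun e => hz (e ▸ hi)
      by_cases e' : z = y
      · subst e'; exact attachFork_new _ e
      · rw [attachFork_of_ne _ e e']; exact h.empty z (by simp [hz, e'])
    · rw [hlab, h.labels_eq, Ico_val_eq_cons hj]
  · rintro ⟨h, hn⟩
    have hinc := h.increase i
    rw [attachFork_self, labelsIncrease_node] at hinc
    have hchild : LeafOrTwoChildren (F y) ∧
        (i ≠ 0 → F i ≠ nil ∧ LeafOrTwoChildren (F i)) ∧ (i = 0 → IsRightmost (F i)) := by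
      by_cases e : i = 0
      · subst e
        have := h.rightmost
        rw [attachFork_self] at this
        exact ⟨this.2.1, by simp, fun _ => this.2.2⟩
      · have := (h.full i hi e).2
        rw [attachFork_self] at this
        exact ⟨this.2.1, fun _ => ⟨fun e' => hn (this.1.2 e'), this.2.2⟩, fun e' => absurd e' e⟩
    refine ⟨fun z => ?_, fun z hz hz0 => ?_, ?_, fun z hz => ?_, ?_⟩
    · by_cases e : z = i
      · subst e; exact hinc.2.2.2
      · by_cases e' : z = y
        · subst e'; exact hinc.2.2.1
        · rw [← attachFork_of_ne (j := j) F e e']; exact h.increase z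
    · by_cases e : z = i
      · subst e; exact hchild.2.1 hz0
      · by_cases e' : z = y
        · subst e'; exact ⟨hn, hchild.1⟩
        · rw [← attachFork_of_ne (j := j) F e e']
          exact h.full z (by simpa [e'] using hz) hz0
    · by_cases e : 0 = i
      · subst e; exact hchild.2.2 rfl
      · rw [← attachFork_of_ne (j := j) F e hy0.symm]; exact h.rightmost
    · simp only [Finset.mem_insert, not_or] at hz
      have e : z ≠ i := fun e => hz.2 (e ▸ hi)
      rw [← attachFork_of_ne (j := j) F e hz.1]; exact h.empty z hz.2
    · have := h.labels_eq
      rwa [hlab, Ico_val_eq_cons hj, Multiset.cons_inj_right] at this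

/-! ### Removing the smallest label of a forest. -/

theorem encard_finset_biUnion {α : Type*} (s : Finset ℕ) (S : ℕ → Set α)
    (h : ∀ i ∈ s, ∀ i' ∈ s, i ≠ i' → Disjoint (S i) (S i')) :
    (⋃ i ∈ s, S i).encard = ∑ i ∈ s, (S i).encard := by
  have := s.finite_toSet.encard_biUnion (s := S) fun i hi i' hi' hne => h i hi i' hi' hne
  rw [finsum_mem_coe_finset] at this
  simpa using this

theorem IsForest.root_ne {j M : ℕ} {B : Finset ℕ} {F : ℕ → BinaryTree ℕ}
    (h : IsForest (j + 1) M B F) (z : ℕ) : rootLabel (F z) ≠ some j := by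
  intro e
  have := (h.bounds (rootLabel_mem_labels e)).1
  omega

theorem IsForest.attachLeaf_root {j M i : ℕ} {B : Finset ℕ} {F : ℕ → BinaryTree ℕ}
    (h : IsForest (j + 1) M B F) (z : ℕ) :
    rootLabel (attachLeaf j i F z) = some j ↔ z = i := by
  by_cases e : z = i
  · subst e; simp [attachLeaf_self, rootLabel]
  · simp [attachLeaf_of_ne F e, h.root_ne, e]

theorem IsForest.attachFork_root {j M i y : ℕ} {B : Finset ℕ} {F : ℕ → BinaryTree ℕ}
    (h : IsForest (j + 1) M B F) (z : ℕ) :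
    rootLabel (attachFork j i y F z) = some j ↔ z = i := by
  by_cases e : z = i
  · subst e; simp [attachFork_self, rootLabel]
  · by_cases e' : z = y
    · subst e'; simp [attachFork_new F e, rootLabel, e]
    · simp [attachFork_of_ne F e e', h.root_ne, e]

/-- Forests are built by placing the smallest label, on a leaf or on a node with children. -/
theorem encard_forests {j M y : ℕ} {B : Finset ℕ} (hj : j < M) (h0 : 0 ∈ B) (hy : y ∉ B)
    (Q : (ℕ → BinaryTree ℕ) → Prop) :
    {F | IsForest j M B F ∧ Q F}.encard =
      ∑ i ∈ B.erase 0, {F | IsForest (j + 1) M (B.erase i) F ∧ Q (attachLeaf j i F)}.encard +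
      ∑ i ∈ B, {F | IsForest (j + 1) M (insert y B) F ∧ Q (attachFork j i y F)}.encard := by
  have hsplit : {F | IsForest j M B F ∧ Q F} =
      (⋃ i ∈ B.erase 0, attachLeaf j i ''
        {F | IsForest (j + 1) M (B.erase i) F ∧ Q (attachLeaf j i F)}) ∪
      ⋃ i ∈ B, attachFork j i y ''
        {F | IsForest (j + 1) M (insert y B) F ∧ Q (attachFork j i y F)} := by
    ext F
    simp only [Set.mem_union, Set.mem_iUnion, Set.mem_image, Set.mem_ofPred_eq]
    constructor
    · rintro ⟨hF, hQ⟩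
      obtain ⟨i, hi, hji⟩ := hF.exists_slot le_rfl hj
      have hroot := (hF.increase i).rootLabel_of_min hji fun b hb => (hF.bounds hb).1
      rcases hFi : F i with _ | ⟨a, l, r⟩
      · simp [hFi, rootLabel] at hroot
      simp only [hFi, rootLabel, Option.some.injEq] at hroot
      subst hroot
      by_cases hl : l = nil
      · have hi0 : i ≠ 0 := by
          rintro rfl
          have := hF.rightmost
          rw [hFi] at this
          exact this.1 hl
        have hr : r = nil := by
          have := (hF.full i hi hi0).2
          rw [hFi] at this
          exact this.1.1 hl
        subst hl hr
        have e : attachLeaf a i (Function.update F i nil) = F := by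
          rw [attachLeaf, Function.update_idem, ← hFi, Function.update_eq_self]
        refine Or.inl ⟨i, Finset.mem_erase.2 ⟨hi0, hi⟩, Function.update F i nil, ⟨?_, ?_⟩, e⟩
        · rw [isForest_attachLeaf_iff (Ico_val_eq_cons hj) hi hi0, e]
          exact ⟨hF, by simp⟩
        · rwa [e]
      · have hyi : y ≠ i := fun e => hy (e ▸ hi)
        have e : attachFork a i y (Function.update (Function.update F i r) y l) = F := by
          funext z
          by_cases hz : z = i
          · subst hz; rw [attachFork_self]; simp [hyi.symm, hFi]
          · by_cases hz' : z = y
            · subst hz'; rw [attachFork_new _ hyi, hF.empty _ hy]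
            · rw [attachFork_of_ne _ hz hz']; simp [hz, hz']
        refine Or.inr ⟨i, hi, Function.update (Function.update F i r) y l, ⟨?_, ?_⟩, e⟩
        · rw [isForest_attachFork_iff hj h0 hi hy, e]
          exact ⟨hF, by simpa using hl⟩
        · rwa [e]
    · rintro (⟨i, hi, F', ⟨hF', hQ⟩, rfl⟩ | ⟨i, hi, F', ⟨hF', hQ⟩, rfl⟩)
      · rw [Finset.mem_erase] at hi
        exact ⟨((isForest_attachLeaf_iff (Ico_val_eq_cons hj) hi.2 hi.1).1 hF').1, hQ⟩
      · exact ⟨((isForest_attachFork_iff hj h0 hi hy).1 hF').1, hQ⟩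
  rw [hsplit, Set.encard_union_eq, encard_finset_biUnion, encard_finset_biUnion]
  · congr 1
    · refine Finset.sum_congr rfl fun i hi => Set.InjOn.encard_image ?_
      rintro F ⟨hF, -⟩ G ⟨hG, -⟩ e
      funext z
      by_cases hz : z = i
      · subst hz; rw [hF.empty _ (by simp), hG.empty _ (by simp)]
      · simpa [attachLeaf_of_ne _ hz] using congrFun e z
    · refine Finset.sum_congr rfl fun i hi => Set.InjOn.encard_image ?_
      rintro F - G - e
      have hi' := congrFun e i
      rw [attachFork_self, attachFork_self, node.injEq] at hi'
      funext z
      by_cases hz : z = i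
      · subst hz; exact hi'.2.2
      · by_cases hz' : z = y
        · subst hz'; exact hi'.2.1
        · simpa [attachFork_of_ne _ hz hz'] using congrFun e z
  · intro i _ i' _ hne
    rw [Set.disjoint_left]
    rintro _ ⟨F, ⟨hF, -⟩, rfl⟩ ⟨G, ⟨hG, -⟩, e⟩
    exact hne ((hG.attachFork_root i).1 (e ▸ (hF.attachFork_root i).2 rfl))
  · intro i _ i' _ hne
    rw [Set.disjoint_left]
    rintro _ ⟨F, ⟨hF, -⟩, rfl⟩ ⟨G, ⟨hG, -⟩, e⟩
    exact hne ((hG.attachLeaf_root i).1 (e ▸ (hF.attachLeaf_root i).2 rfl))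
  · rw [Set.disjoint_left]
    simp only [Set.mem_iUnion, not_exists]
    rintro _ h i' hi'
    obtain ⟨i, hi, F, ⟨hF, -⟩, rfl⟩ := h
    rintro ⟨G, ⟨hG, -⟩, e⟩
    have hii : i = i' := (hG.attachFork_root i).1 (e ▸ (hF.attachLeaf_root i).2 rfl)
    subst hii
    have h1 := congrFun e i
    rw [attachFork_self, attachLeaf_self, node.injEq] at h1
    -- The same label cannot be both a leaf and a node with children, since the left subtree of the
    -- latter is nonempty.
    exact (hG.full y (by simp) fun e => hy (e ▸ h0)).1 h1.2.1

/-! ### Counting forests -/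

theorem encard_congr_of_isForest {j M : ℕ} {B : Finset ℕ} {P Q : (ℕ → BinaryTree ℕ) → Prop}
    (h : ∀ F, IsForest j M B F → (P F ↔ Q F)) :
    {F | IsForest j M B F ∧ P F}.encard = {F | IsForest j M B F ∧ Q F}.encard := by
  congr 1
  ext F
  exact and_congr_right (h F)

theorem encard_eq_zero_of_isForest {j M : ℕ} {B : Finset ℕ} {P : (ℕ → BinaryTree ℕ) → Prop}
    (h : ∀ F, IsForest j M B F → ¬ P F) : {F | IsForest j M B F ∧ P F}.encard = 0 := by
  rw [Set.encard_eq_zero, Set.eq_empty_iff_forall_notMem]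
  rintro F ⟨h1, h2⟩
  exact h F h1 h2

theorem card_erase_of_mem_erase {a i : ℕ} {B : Finset ℕ} (hB : B.card = a + 1)
    (hi : i ∈ B.erase 0) (h0 : 0 ∈ B) : (B.erase i).card = (a - 1) + 1 ∧ 0 ∈ B.erase i := by
  rw [Finset.mem_erase] at hi
  have h1 : 1 < B.card := Finset.one_lt_card.2 ⟨i, hi.2, 0, h0, hi.1⟩
  refine ⟨?_, Finset.mem_erase.2 ⟨hi.1.symm, h0⟩⟩
  rw [Finset.card_erase_of_mem hi.2]
  omega

/-- A property of forests that does not change when `j` is placed. -/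
def IsStable (R : (ℕ → BinaryTree ℕ) → Prop) (j M : ℕ) : Prop :=
  (∀ B F i, IsForest (j + 1) M B F → i ∉ B → (R (attachLeaf j i F) ↔ R F)) ∧
  ∀ B F i y, IsForest (j + 1) M B F → y ≠ i → (R (attachFork j i y F) ↔ R F)

/-- A leaf has `a` possible slots and leaves a - 1 ordinary ones, a node with children has a + 1 and
leaves a + 1. Stability lets the property pass to the smaller forest. -/
theorem encard_forests_of_isStable {j M a : ℕ} {B : Finset ℕ} {R : (ℕ → BinaryTree ℕ) → Prop}
    (hj : j < M) (h0 : 0 ∈ B) (hB : B.card = a + 1) (hR : IsStable R j M) {φ : ℕ → ℕ}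
    (hφ : ∀ (B : Finset ℕ) (a : ℕ), 0 ∈ B → B.card = a + 1 →
      {F | IsForest (j + 1) M B F ∧ R F}.encard = φ a) :
    {F | IsForest j M B F ∧ R F}.encard = transfer φ a := by
  obtain ⟨y, hy⟩ := Infinite.exists_notMem_finset B
  rw [encard_forests hj h0 hy]
  have h1 : ∀ i ∈ B.erase 0,
      {F | IsForest (j + 1) M (B.erase i) F ∧ R (attachLeaf j i F)}.encard = φ (a - 1) := by
    intro i hi
    obtain ⟨hc, h0'⟩ := card_erase_of_mem_erase hB hi h0
    rw [← hφ _ _ h0' hc]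
    exact encard_congr_of_isForest fun F hF => hR.1 _ F i hF (by simp)
  have h2 : ∀ i ∈ B,
      {F | IsForest (j + 1) M (insert y B) F ∧ R (attachFork j i y F)}.encard = φ (a + 1) := by
    intro i hi
    rw [← hφ (insert y B) (a + 1) (by simp [h0]) (by rw [Finset.card_insert_of_notMem hy, hB])]
    exact encard_congr_of_isForest fun F hF => hR.2 _ F i y hF fun e => hy (e ▸ hi)
  rw [Finset.sum_congr rfl h1, Finset.sum_congr rfl h2, Finset.sum_const, Finset.sum_const, hB,
    Finset.card_erase_of_mem h0, hB, transfer_apply]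
  simp

theorem isStable_true (j M : ℕ) : IsStable (fun _ => True) j M := by simp [IsStable]

/-- Without labels all trees are empty, which only slot `0` allows. -/
theorem encard_isForest_self {M a : ℕ} {B : Finset ℕ} (h0 : 0 ∈ B) (hB : B.card = a + 1) :
    {F | IsForest M M B F}.encard = vacuum a := by
  have hnil : ∀ F, IsForest M M B F → ∀ i, F i = nil := by
    intro F hF i
    rw [← labels_eq_nil, List.eq_nil_iff_forall_not_mem]
    intro b hb
    have := hF.bounds hb
    omega
  by_cases ha : a = 0
  · subst ha
    have hB' : B = {0} := by
      obtain ⟨x, rfl⟩ := Finset.card_eq_one.1 hB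
      simpa [eq_comm] using h0
    have : {F | IsForest M M B F} = {fun _ => nil} := by
      ext F
      simp only [Set.mem_ofPred_eq, Set.mem_singleton_iff]
      refine ⟨fun h => funext (hnil F h), ?_⟩
      rintro rfl
      subst hB'
      exact ⟨fun _ => trivial, fun i hi hi0 => absurd (by simpa using hi) hi0, trivial,
        fun _ _ => rfl, by simp [labels]⟩
    rw [this, Set.encard_singleton]
    simp [vacuum]
  · have : {F | IsForest M M B F} = ∅ := by
      rw [Set.eq_empty_iff_forall_notMem]
      intro F hF
      have : 1 < B.card := by omega
      obtain ⟨x, hx, hx0⟩ := Finset.exists_mem_ne this 0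
      exact (hF.full x hx hx0).1 (hnil F hF x)
    rw [this, Set.encard_empty]
    simp [vacuum, ha]

theorem encard_isForest {d j M a : ℕ} {B : Finset ℕ} (h0 : 0 ∈ B) (hB : B.card = a + 1)
    (hd : j + d = M) : {F | IsForest j M B F}.encard = (transfer ^ d) vacuum a := by
  induction d generalizing j a B with
  | zero =>
    subst hd
    simpa using encard_isForest_self h0 hB
  | succ d ih =>
    have := encard_forests_of_isStable (by omega) h0 hB (isStable_true j M)
      (φ := (transfer ^ d) vacuum) fun B a h0 hB => by
        simpa using ih h0 hB (by omega)
    rw [pow_succ', Module.End.mul_apply]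
    simpa using this

/-! ### The parent of the largest label -/

/-- Some tree of the forest has a node labelled `k` with a child labelled `N`. -/
def ForestParent (k N : ℕ) (F : ℕ → BinaryTree ℕ) : Prop := ∃ z, HasParent k N (F z)

/-- Placing j on top of existing trees keeps their edges, and every new edge starts from j. -/
theorem isStable_forestParent {j k N M : ℕ} (h : j ≠ k) : IsStable (ForestParent k N) j M := by
  refine ⟨fun B F i hF hi => ⟨?_, ?_⟩, fun B F i y hF hy => ⟨?_, ?_⟩⟩
  · rintro ⟨z, hz⟩
    by_cases e : z = i
    · subst e; simp [attachLeaf_self, HasParent, rootLabel] at hz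
    · rw [attachLeaf_of_ne F e] at hz; exact ⟨z, hz⟩
  · rintro ⟨z, hz⟩
    have e : z ≠ i := by
      rintro rfl
      rw [hF.empty _ hi] at hz
      exact hz
    exact ⟨z, by rwa [attachLeaf_of_ne F e]⟩
  · rintro ⟨z, hz⟩
    by_cases e : z = i
    · subst e
      simp only [attachFork_self, HasParent, h, false_and, false_or] at hz
      exact hz.elim (fun hz => ⟨_, hz⟩) fun hz => ⟨_, hz⟩
    · by_cases e' : z = y
      · subst e'; rw [attachFork_new F e] at hz; exact hz.elim
      · rw [attachFork_of_ne F e e'] at hz; exact ⟨z, hz⟩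
  · rintro ⟨z, hz⟩
    by_cases e : z = i
    · subst e; exact ⟨z, by rw [attachFork_self]; exact Or.inr (Or.inr hz)⟩
    · by_cases e' : z = y
      · subst e'; exact ⟨i, by rw [attachFork_self]; exact Or.inr (Or.inl hz)⟩
      · exact ⟨z, by rwa [attachFork_of_ne F e e']⟩

theorem IsForest.not_forestParent {k N M : ℕ} {B : Finset ℕ} {F : ℕ → BinaryTree ℕ}
    (hF : IsForest (k + 1) M B F) (z : ℕ) : ¬ HasParent k N (F z) := by
  intro h
  have := (hF.bounds h.parent_mem).1
  omega

theorem forestParent_attachLeaf {k N M i : ℕ} {B : Finset ℕ} {F : ℕ → BinaryTree ℕ}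
    (hF : IsForest (k + 1) M B F) : ¬ ForestParent k N (attachLeaf k i F) := by
  rintro ⟨z, hz⟩
  by_cases e : z = i
  · subst e; simp [attachLeaf_self, HasParent, rootLabel] at hz
  · rw [attachLeaf_of_ne F e] at hz; exact hF.not_forestParent z hz

theorem forestParent_attachFork {k N M i y : ℕ} {B : Finset ℕ} {F : ℕ → BinaryTree ℕ}
    (hF : IsForest (k + 1) M B F) :
    ForestParent k N (attachFork k i y F) ↔
      rootLabel (F y) = some N ∨ rootLabel (F i) = some N := by
  constructor
  · rintro ⟨z, hz⟩
    by_cases e : z = i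
    · subst e
      simpa [attachFork_self, HasParent, hF.not_forestParent] using hz
    · by_cases e' : z = y
      · subst e'; rw [attachFork_new F e] at hz; exact hz.elim
      · rw [attachFork_of_ne F e e'] at hz; exact (hF.not_forestParent z hz).elim
  · intro h
    exact ⟨i, by rw [attachFork_self]; exact Or.inl ⟨rfl, h⟩⟩

/-- A tree whose root carries the largest label is a leaf. -/
theorem IsForest.eq_leaf {j N y : ℕ} {B : Finset ℕ} {F : ℕ → BinaryTree ℕ}
    (hF : IsForest j (N + 1) B F) (h : rootLabel (F y) = some N) : F y = node N nil nil := by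
  have hinc := hF.increase y
  have hb := fun b => hF.bounds (i := y) (b := b)
  rcases hy : F y with _ | ⟨a, l, r⟩
  · simp [hy, rootLabel] at h
  · simp only [hy, rootLabel, Option.some.injEq] at h
    subst h
    rw [hy, labelsIncrease_node] at hinc
    rw [hy] at hb
    have hl : l = nil := by
      rw [← labels_eq_nil, List.eq_nil_iff_forall_not_mem]
      intro b hbl
      have h1 := hinc.1 b hbl
      have h2 := hb b (by simp [labels, hbl])
      omega
    have hr : r = nil := by
      rw [← labels_eq_nil, List.eq_nil_iff_forall_not_mem]
      intro b hbl
      have h1 := hinc.2.1 b hbl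
      have h2 := hb b (by simp [labels, hbl])
      omega
    rw [hl, hr]

/-- Nothing can lie below the largest label, so its tree is a leaf; deleting it removes both the
label and the slot. -/
theorem encard_isForest_rootLabel {j N y : ℕ} {B : Finset ℕ} (hj : j ≤ N) (hy : y ∈ B)
    (hy0 : y ≠ 0) : {F | IsForest j (N + 1) B F ∧ rootLabel (F y) = some N}.encard =
      {F | IsForest j N (B.erase y) F}.encard := by
  have hval : (Finset.Ico j (N + 1)).val = N ::ₘ (Finset.Ico j N).val := by
    rw [← Finset.insert_Ico_right_eq_Ico_add_one hj, Finset.insert_val_of_notMem (by simp)]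
  have himg : {F | IsForest j (N + 1) B F ∧ rootLabel (F y) = some N} =
      attachLeaf N y '' {F | IsForest j N (B.erase y) F} := by
    ext F
    simp only [Set.mem_ofPred_eq, Set.mem_image]
    constructor
    · rintro ⟨hF, hr⟩
      have e : attachLeaf N y (Function.update F y nil) = F := by
        rw [attachLeaf, Function.update_idem, ← hF.eq_leaf hr, Function.update_eq_self]
      refine ⟨Function.update F y nil, ?_, e⟩
      rw [isForest_attachLeaf_iff hval hy hy0, e]
      exact ⟨hF, by simp⟩
    · rintro ⟨F', hF', rfl⟩
      exact ⟨((isForest_attachLeaf_iff hval hy hy0).1 hF').1, by simp [attachLeaf_self, rootLabel]⟩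
  rw [himg]
  refine Set.InjOn.encard_image ?_
  intro F hF G hG e
  funext z
  by_cases hz : z = y
  · subst hz
    rw [IsForest.empty hF _ (by simp), IsForest.empty hG _ (by simp)]
  · simpa [attachLeaf_of_ne _ hz] using congrFun e z

/-- The labels before k act by `transfer`. The node k opens one slot and the leaf N occupies one, so
that `a` is unchanged, with 2a + 1 choices in all. -/
theorem encard_forestParent {d j k N a : ℕ} {B : Finset ℕ} (h0 : 0 ∈ B) (hB : B.card = a + 1)
    (hd : j + d = k) (hk : k < N) :
    {F | IsForest j (N + 1) B F ∧ ForestParent k N F}.encard =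
      (transfer ^ d) (weight ((transfer ^ (N - 1 - k)) vacuum)) a := by
  induction d generalizing j a B with
  | zero =>
    obtain rfl : j = k := by omega
    obtain ⟨y, hy⟩ := Infinite.exists_notMem_finset B
    have hy0 : y ≠ 0 := fun e => hy (e ▸ h0)
    rw [encard_forests (by omega) h0 hy]
    have h1 : ∀ i ∈ B.erase 0, {F | IsForest (j + 1) (N + 1) (B.erase i) F ∧
        ForestParent j N (attachLeaf j i F)}.encard = 0 := fun i _ =>
      encard_eq_zero_of_isForest fun F hF => forestParent_attachLeaf hF
    have hroot : ∀ i ∈ insert y B, i ≠ 0 → {F | IsForest (j + 1) (N + 1) (insert y B) F ∧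
        rootLabel (F i) = some N}.encard = (transfer ^ (N - 1 - j)) vacuum a := by
      intro i hi hi0
      rw [encard_isForest_rootLabel hk hi hi0]
      refine encard_isForest (by simp [h0, hi0.symm]) ?_ (by omega)
      rw [Finset.card_erase_of_mem hi, Finset.card_insert_of_notMem hy, hB]
      omega
    have h2 : ∀ i ∈ B.erase 0, {F | IsForest (j + 1) (N + 1) (insert y B) F ∧
        ForestParent j N (attachFork j i y F)}.encard =
          ((2 * (transfer ^ (N - 1 - j)) vacuum a : ℕ) : ℕ∞) := by
      intro i hi
      rw [Finset.mem_erase] at hi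
      rw [encard_congr_of_isForest fun F hF => forestParent_attachFork hF]
      have : {F | IsForest (j + 1) (N + 1) (insert y B) F ∧
          (rootLabel (F y) = some N ∨ rootLabel (F i) = some N)} =
          {F | IsForest (j + 1) (N + 1) (insert y B) F ∧ rootLabel (F y) = some N} ∪
          {F | IsForest (j + 1) (N + 1) (insert y B) F ∧ rootLabel (F i) = some N} := by
        ext F
        exact and_or_left
      rw [this, Set.encard_union_eq, hroot y (by simp) hy0, hroot i (by simp [hi.2]) hi.1]
      · push_cast; ring
      · rw [Set.disjoint_left]
        rintro F ⟨hF, hFy⟩ ⟨-, hFi⟩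
        have := hF.slot_unique (rootLabel_mem_labels hFy) (rootLabel_mem_labels hFi)
        exact hy (this ▸ hi.2)
    have h3 : {F | IsForest (j + 1) (N + 1) (insert y B) F ∧
        ForestParent j N (attachFork j 0 y F)}.encard =
          (transfer ^ (N - 1 - j)) vacuum a := by
      rw [encard_congr_of_isForest fun F hF => forestParent_attachFork hF,
        ← hroot y (by simp) hy0]
      -- At the rightmost slot N can only be the left child: a leaf is not an admissible tree on
      -- slot `0`.
      refine encard_congr_of_isForest fun F hF => or_iff_left fun h => ?_
      have := hF.rightmost
      rw [hF.eq_leaf h] at this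
      exact this.1 rfl
    rw [Finset.sum_eq_zero h1, ← Finset.add_sum_erase _ _ h0, h3, Finset.sum_congr rfl h2,
      Finset.sum_const, Finset.card_erase_of_mem h0, hB, pow_zero, Module.End.one_apply,
      weight_apply]
    simp only [add_tsub_cancel_right, nsmul_eq_mul]
    push_cast
    ring
  | succ d ih =>
    rw [pow_succ', Module.End.mul_apply]
    exact encard_forests_of_isStable (by omega) h0 hB (isStable_forestParent (by omega))
      fun B a h0 hB => ih h0 hB (by omega)

/-! ### The end of the minimal chain -/

section Chain

variable {j M : ℕ} {B : Finset ℕ} {F : ℕ → BinaryTree ℕ}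

theorem IsForest.le_chainEnd (hF : IsForest j M B F) {c c' : ℕ} (hc : c ∈ B) (hc0 : c ≠ 0) :
    j ≤ chainEnd (F c) (F c') := by
  rcases chainEnd_mem_labels (r := F c') (hF.full c hc hc0).1 with h | h
  · exact (hF.bounds h).1
  · exact (hF.bounds h).1

theorem chainEnd_attachLeaf_left (hF : IsForest (j + 1) M B F) {c c' : ℕ} (h : c' ≠ c) :
    chainEnd (attachLeaf j c F c) (attachLeaf j c F c') = j := by
  rw [attachLeaf_self, attachLeaf_of_ne F h,
    chainEnd_eq_eoc_left fun b hb => (hF.bounds hb).1]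
  rfl

theorem chainEnd_attachLeaf_right (hF : IsForest (j + 1) M B F) {c c' : ℕ} (h : c ≠ c') :
    chainEnd (attachLeaf j c' F c) (attachLeaf j c' F c') = j := by
  rw [attachLeaf_self, attachLeaf_of_ne F h,
    chainEnd_eq_eoc_right fun b hb => (hF.bounds hb).1]
  rfl

theorem chainEnd_attachFork_left (hF : IsForest (j + 1) M B F) {c c' y : ℕ} (h : c' ≠ c)
    (hy : y ≠ c') (hyB : F y ≠ nil) :
    chainEnd (attachFork j c y F c) (attachFork j c y F c') = chainEnd (F y) (F c) := by
  rw [attachFork_self, attachFork_of_ne F h hy.symm,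
    chainEnd_eq_eoc_left fun b hb => (hF.bounds hb).1, eoc_node hyB]

theorem chainEnd_attachFork_right (hF : IsForest (j + 1) M B F) {c c' y : ℕ} (h : c ≠ c')
    (hy : y ≠ c) (hyB : F y ≠ nil) :
    chainEnd (attachFork j c' y F c) (attachFork j c' y F c') = chainEnd (F y) (F c') := by
  rw [attachFork_self, attachFork_of_ne F h hy.symm,
    chainEnd_eq_eoc_right fun b hb => (hF.bounds hb).1, eoc_node hyB]

end Chain

/-- The forests that come from a node with children on the slots `c` and `c'`, where the minimal
chain ends with `m`. -/
def ChainSet (R : (ℕ → BinaryTree ℕ) → Prop) (m j M : ℕ) (B : Finset ℕ) (c c' : ℕ) :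
    Set (ℕ → BinaryTree ℕ) :=
  {F | IsForest j M B F ∧ chainEnd (F c) (F c') = m ∧ R F}

/-! ### Recursion for the forests with a prescribed end of the minimal chain. -/

section ChainCount

variable {R : (ℕ → BinaryTree ℕ) → Prop} {m j M y c c' : ℕ} {B : Finset ℕ}

/-- The contribution to `ChainSet` of the forests whose smallest label is on a leaf at `i`. -/
noncomputable def leafPart (R : (ℕ → BinaryTree ℕ) → Prop) (m j M : ℕ) (B : Finset ℕ) (c c' i : ℕ) : ℕ∞ :=
  {F | IsForest (j + 1) M (B.erase i) F ∧
    chainEnd (attachLeaf j i F c) (attachLeaf j i F c') = m ∧ R (attachLeaf j i F)}.encard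

/-- The contribution to `ChainSet` of the forests whose smallest label is on a node at `i` that
has children. -/
noncomputable def forkPart (R : (ℕ → BinaryTree ℕ) → Prop) (m j M y : ℕ) (B : Finset ℕ) (c c' i : ℕ) : ℕ∞ :=
  {F | IsForest (j + 1) M (insert y B) F ∧
    chainEnd (attachFork j i y F c) (attachFork j i y F c') = m ∧ R (attachFork j i y F)}.encard

theorem encard_chainSet (hj : j < M) (h0 : 0 ∈ B) (hy : y ∉ B) :
    (ChainSet R m j M B c c').encard =
      ∑ i ∈ B.erase 0, leafPart R m j M B c c' i + ∑ i ∈ B, forkPart R m j M y B c c' i :=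
  encard_forests hj h0 hy fun F => chainEnd (F c) (F c') = m ∧ R F

theorem chainSet_eq_empty (hc : c ∈ B) (hc0 : c ≠ 0) (hm : m < j) :
    (ChainSet R m j M B c c').encard = 0 := by
  refine encard_eq_zero_of_isForest fun F hF h => ?_
  have := hF.le_chainEnd (c' := c') hc hc0
  omega

/-- The label j is smaller than all remaining ones, so the chain moves to it and stops there. -/
theorem leafPart_left (hR : IsStable R j M) (hne : c' ≠ c) :
    leafPart R m j M B c c' c =
      if j = m then {F | IsForest (j + 1) M (B.erase c) F ∧ R F}.encard else 0 := by
  split_ifs with h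
  · refine encard_congr_of_isForest fun F hF => ?_
    rw [chainEnd_attachLeaf_left hF hne, hR.1 _ F c hF (by simp)]
    simp [h]
  · refine encard_eq_zero_of_isForest fun F hF => ?_
    rw [chainEnd_attachLeaf_left hF hne]
    simp [h]

theorem leafPart_right (hR : IsStable R j M) (hne : c ≠ c') :
    leafPart R m j M B c c' c' =
      if j = m then {F | IsForest (j + 1) M (B.erase c') F ∧ R F}.encard else 0 := by
  split_ifs with h
  · refine encard_congr_of_isForest fun F hF => ?_
    rw [chainEnd_attachLeaf_right hF hne, hR.1 _ F c' hF (by simp)]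
    simp [h]
  · refine encard_eq_zero_of_isForest fun F hF => ?_
    rw [chainEnd_attachLeaf_right hF hne]
    simp [h]

theorem leafPart_of_ne (hR : IsStable R j M) {i : ℕ} (h : c ≠ i) (h' : c' ≠ i) :
    leafPart R m j M B c c' i = (ChainSet R m (j + 1) M (B.erase i) c c').encard := by
  refine encard_congr_of_isForest fun F hF => ?_
  rw [attachLeaf_of_ne F h, attachLeaf_of_ne F h', hR.1 _ F i hF (by simp)]

/-- The chain moves to j, whose child slots y and c form the new pair; c' becomes an ordinary slot.
-/
theorem forkPart_left (hR : IsStable R j M) (hne : c' ≠ c) (hy : y ∉ B) (hy0 : y ≠ 0)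
    (hc : c ∈ B) (hc' : c' ∈ B) :
    forkPart R m j M y B c c' c = (ChainSet R m (j + 1) M (insert y B) y c).encard := by
  refine encard_congr_of_isForest fun F hF => ?_
  rw [chainEnd_attachFork_left hF hne (ne_of_mem_of_not_mem hc' hy).symm (hF.full y (by simp) hy0).1,
    hR.2 _ F c y hF fun e => hy (e ▸ hc)]

theorem forkPart_right (hR : IsStable R j M) (hne : c ≠ c') (hy : y ∉ B) (hy0 : y ≠ 0)
    (hc : c ∈ B) (hc' : c' ∈ B) :
    forkPart R m j M y B c c' c' = (ChainSet R m (j + 1) M (insert y B) y c').encard := by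
  refine encard_congr_of_isForest fun F hF => ?_
  rw [chainEnd_attachFork_right hF hne (ne_of_mem_of_not_mem hc hy).symm (hF.full y (by simp) hy0).1,
    hR.2 _ F c' y hF fun e => hy (e ▸ hc')]

theorem forkPart_of_ne (hR : IsStable R j M) {i : ℕ} (hy : y ∉ B) (hc : c ∈ B) (hc' : c' ∈ B)
    (hi : i ∈ B) (h : c ≠ i) (h' : c' ≠ i) :
    forkPart R m j M y B c c' i = (ChainSet R m (j + 1) M (insert y B) c c').encard := by
  refine encard_congr_of_isForest fun F hF => ?_
  rw [attachFork_of_ne F h (ne_of_mem_of_not_mem hc hy),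
    attachFork_of_ne F h' (ne_of_mem_of_not_mem hc' hy),
    hR.2 _ F i y hF fun e => hy (e ▸ hi)]

/-- When the chain ends with the label `j` to be placed, no node with children is placed. -/
theorem forkPart_eq_zero (hR : IsStable R j M) (hne : c ≠ c') (hy : y ∉ B) (hy0 : y ≠ 0)
    (hc : c ∈ B) (hc' : c' ∈ B) (hc0 : c ≠ 0) (hjm : j = m) {i : ℕ} (hi : i ∈ B) :
    forkPart R m j M y B c c' i = 0 := by
  by_cases h : c = i
  · rw [← h, forkPart_left hR hne.symm hy hy0 hc hc']
    exact chainSet_eq_empty (by simp) hy0 (by omega)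
  · by_cases h' : c' = i
    · rw [← h', forkPart_right hR hne hy hy0 hc hc']
      exact chainSet_eq_empty (by simp) hy0 (by omega)
    · rw [forkPart_of_ne hR hy hc hc' hi h h']
      exact chainSet_eq_empty (by simp [hc]) hc0 (by omega)

theorem leafPart_eq_zero (hR : IsStable R j M) (hc : c ∈ B) (hc0 : c ≠ 0) (hjm : j = m) {i : ℕ}
    (h : c ≠ i) (h' : c' ≠ i) : leafPart R m j M B c c' i = 0 := by
  rw [leafPart_of_ne hR h h']
  exact chainSet_eq_empty (by simp [hc, h]) hc0 (by omega)

/-- Chains that have left the rightmost path. -/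
theorem encard_chainSet_inner {d a : ℕ} {φ : ℕ → ℕ} (hm : m < M)
    (hR : ∀ j ≤ m, IsStable R j M)
    (hφ : ∀ (B : Finset ℕ) (a : ℕ), 0 ∈ B → B.card = a + 1 →
      {F | IsForest (m + 1) M B F ∧ R F}.encard = φ a)
    (hd : j + d = m) (h0 : 0 ∈ B) (hc : c ∈ B) (hc' : c' ∈ B) (hc0 : c ≠ 0) (hc0' : c' ≠ 0)
    (hne : c ≠ c') (hB : B.card = a + 3) :
    (ChainSet R m j M B c c').encard = (transferThree ^ d) (twoShift φ) a := by
  induction d generalizing j a B c c' with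
  | zero =>
    obtain ⟨y, hy⟩ := Infinite.exists_notMem_finset B
    have hy0 : y ≠ 0 := fun e => hy (e ▸ h0)
    have hjm : j = m := by omega
    have hRj := hR j hjm.le
    have hl : ∀ c ∈ B, c ≠ 0 → {F | IsForest (j + 1) M (B.erase c) F ∧ R F}.encard =
        φ (a + 1) := by
      intro c hc hc0
      rw [hjm]
      exact hφ _ _ (by simp [h0, hc0.symm]) (by rw [Finset.card_erase_of_mem hc, hB]; rfl)
    -- The leaf m goes to c or to c', which leaves a + 1 ordinary slots: this is `twoShift`.
    rw [encard_chainSet (by omega) h0 hy,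
      Finset.sum_eq_zero fun i hi => forkPart_eq_zero hRj hne hy hy0 hc hc' hc0 hjm hi,
      ← Finset.add_sum_erase _ _ (Finset.mem_erase.2 ⟨hc0, hc⟩),
      ← Finset.add_sum_erase _ _ (Finset.mem_erase.2 ⟨hne.symm, Finset.mem_erase.2 ⟨hc0', hc'⟩⟩),
      Finset.sum_eq_zero fun i hi => ?_, leafPart_left hRj hne.symm, leafPart_right hRj hne,
      if_pos hjm, if_pos hjm, hl c hc hc0, hl c' hc' hc0', pow_zero, Module.End.one_apply,
      twoShift_apply]
    · push_cast; ring
    · simp only [Finset.mem_erase] at hi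
      exact leafPart_eq_zero hRj hc hc0 hjm (Ne.symm hi.2.1) (Ne.symm hi.1)
  | succ d ih =>
    obtain ⟨y, hy⟩ := Infinite.exists_notMem_finset B
    have hy0 : y ≠ 0 := fun e => hy (e ▸ h0)
    have hRj := hR j (by omega)
    have hjm : j ≠ m := by omega
    have hcB : (insert y B).card = (a + 1) + 3 := by
      rw [Finset.card_insert_of_notMem hy, hB]
    have hfork : ∀ i ∈ B, forkPart R m j M y B c c' i =
        (transferThree ^ d) (twoShift φ) (a + 1) := by
      intro i hi
      by_cases h : c = i
      · rw [← h, forkPart_left hRj hne.symm hy hy0 hc hc']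
        exact ih (by omega) (by simp [h0]) (by simp) (by simp [hc]) hy0 hc0
          (fun e => hy (e ▸ hc)) hcB
      · by_cases h' : c' = i
        · rw [← h', forkPart_right hRj hne hy hy0 hc hc']
          exact ih (by omega) (by simp [h0]) (by simp) (by simp [hc']) hy0 hc0'
            (fun e => hy (e ▸ hc')) hcB
        · rw [forkPart_of_ne hRj hy hc hc' hi h h']
          exact ih (by omega) (by simp [h0]) (by simp [hc]) (by simp [hc']) hc0 hc0' hne hcB
    have hmem : c' ∈ (B.erase 0).erase c :=
      Finset.mem_erase.2 ⟨hne.symm, Finset.mem_erase.2 ⟨hc0', hc'⟩⟩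
    have hcard : (((B.erase 0).erase c).erase c').card = a := by
      rw [Finset.card_erase_of_mem hmem,
        Finset.card_erase_of_mem (Finset.mem_erase.2 ⟨hc0, hc⟩), Finset.card_erase_of_mem h0, hB]
      omega
    have hleaf : ∀ i ∈ ((B.erase 0).erase c).erase c', leafPart R m j M B c c' i =
        (transferThree ^ d) (twoShift φ) (a - 1) := by
      intro i hi
      -- The existence of such a slot gives 1 ≤ a, so a - 1 is not truncated.
      have hpos := Finset.card_pos.2 ⟨i, hi⟩
      simp only [Finset.mem_erase] at hi
      rw [leafPart_of_ne hRj (Ne.symm hi.2.1) (Ne.symm hi.1)]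
      refine ih (by omega) (by simp [h0, Ne.symm hi.2.2.1]) (by simp [hc, Ne.symm hi.2.1])
        (by simp [hc', Ne.symm hi.1]) hc0 hc0' hne ?_
      rw [Finset.card_erase_of_mem hi.2.2.2, hB]
      omega
    -- A leaf on c or c' would end the chain too early, so leaves have `a` slots; nodes with
    -- children have all a + 3. Hence `transferThree`.
    rw [encard_chainSet (by omega) h0 hy, Finset.sum_congr rfl hfork,
      ← Finset.add_sum_erase _ _ (Finset.mem_erase.2 ⟨hc0, hc⟩),
      ← Finset.add_sum_erase _ _ hmem, Finset.sum_congr rfl hleaf,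
      leafPart_left hRj hne.symm, leafPart_right hRj hne,
      if_neg hjm, if_neg hjm, pow_succ', Module.End.mul_apply,
      transferThree_apply, Finset.sum_const, Finset.sum_const, hB, hcard]
    simp

/-- Chains that are still on the rightmost path. -/
theorem encard_chainSet_outer {d a : ℕ} {φ : ℕ → ℕ} (hm : m < M)
    (hR : ∀ j ≤ m, IsStable R j M)
    (hφ : ∀ (B : Finset ℕ) (a : ℕ), 0 ∈ B → B.card = a + 1 →
      {F | IsForest (m + 1) M B F ∧ R F}.encard = φ a)
    (hd : j + d = m) (h0 : 0 ∈ B) (hc : c ∈ B) (hc0 : c ≠ 0) (hB : B.card = a + 2) :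
    (ChainSet R m j M B c 0).encard = chainOp d φ a := by
  induction d generalizing j a B c with
  | zero =>
    obtain ⟨y, hy⟩ := Infinite.exists_notMem_finset B
    have hy0 : y ≠ 0 := fun e => hy (e ▸ h0)
    have hjm : j = m := by omega
    have hRj := hR j hjm.le
    -- Slot `0` takes no leaf, so c is the only slot on which m can end the chain.
    rw [encard_chainSet (by omega) h0 hy,
      Finset.sum_eq_zero fun i hi => forkPart_eq_zero hRj hc0 hy hy0 hc h0 hc0 hjm hi,
      ← Finset.add_sum_erase _ _ (Finset.mem_erase.2 ⟨hc0, hc⟩),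
      Finset.sum_eq_zero fun i hi => ?_, leafPart_left hRj hc0.symm, if_pos hjm, hjm,
      hφ _ a (by simp [h0, hc0.symm]) (by rw [Finset.card_erase_of_mem hc, hB]; rfl)]
    · simp [chainOp, mixed]
    · simp only [Finset.mem_erase] at hi
      exact leafPart_eq_zero hRj hc hc0 hjm (Ne.symm hi.1) (Ne.symm hi.2.1)
  | succ d ih =>
    obtain ⟨y, hy⟩ := Infinite.exists_notMem_finset B
    have hy0 : y ≠ 0 := fun e => hy (e ▸ h0)
    have hRj := hR j (by omega)
    have hjm : j ≠ m := by omega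
    have hcB : (insert y B).card = (a + 1) + 2 := by
      rw [Finset.card_insert_of_notMem hy, hB]
    have hfork : ∀ i ∈ B.erase c, forkPart R m j M y B c 0 i = chainOp d φ (a + 1) := by
      intro i hi
      rw [Finset.mem_erase] at hi
      by_cases h' : 0 = i
      · rw [← h', forkPart_right hRj hc0 hy hy0 hc h0]
        exact ih (by omega) (by simp [h0]) (by simp) hy0 hcB
      · rw [forkPart_of_ne hRj hy hc h0 hi.2 (Ne.symm hi.1) h']
        exact ih (by omega) (by simp [h0]) (by simp [hc]) hc0 hcB
    -- Here the chain leaves the rightmost path: the new pair is y and c, away from slot `0`.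
    have hforkc : forkPart R m j M y B c 0 c = (transferThree ^ d) (twoShift φ) a := by
      rw [forkPart_left hRj hc0.symm hy hy0 hc h0]
      exact encard_chainSet_inner hm hR hφ (by omega) (by simp [h0]) (by simp) (by simp [hc]) hy0
        hc0 (fun e => hy (e ▸ hc)) (by rw [Finset.card_insert_of_notMem hy, hB])
    have hcard : ((B.erase 0).erase c).card = a := by
      rw [Finset.card_erase_of_mem (Finset.mem_erase.2 ⟨hc0, hc⟩), Finset.card_erase_of_mem h0, hB]
      omega
    have hleaf : ∀ i ∈ (B.erase 0).erase c, leafPart R m j M B c 0 i = chainOp d φ (a - 1) := by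
      intro i hi
      have hpos := Finset.card_pos.2 ⟨i, hi⟩
      simp only [Finset.mem_erase] at hi
      rw [leafPart_of_ne hRj (Ne.symm hi.1) (Ne.symm hi.2.1)]
      refine ih (by omega) (by simp [h0, Ne.symm hi.2.1]) (by simp [hc, Ne.symm hi.1]) hc0 ?_
      rw [Finset.card_erase_of_mem hi.2.2, hB]
      omega
    rw [encard_chainSet (by omega) h0 hy, ← Finset.add_sum_erase B _ hc, hforkc,
      Finset.sum_congr rfl hfork,
      ← Finset.add_sum_erase _ _ (Finset.mem_erase.2 ⟨hc0, hc⟩), Finset.sum_congr rfl hleaf,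
      leafPart_left hRj hc0.symm, if_neg hjm, chainOp_succ, LinearMap.add_apply,
      Module.End.mul_apply, Module.End.mul_apply, Pi.add_apply,
      transfer_apply, Finset.sum_const, Finset.sum_const, Finset.card_erase_of_mem hc, hB, hcard]
    simp only [zero_add, nsmul_eq_mul, Nat.add_succ_sub_one]
    push_cast
    ring

end ChainCount

/-! ### Counting secant trees -/

theorem IsSecantTree.mem_labels {n : ℕ} {t : BinaryTree ℕ} (h : IsSecantTree n t) {x : ℕ} :
    x ∈ labels t ↔ 1 ≤ x ∧ x ≤ 2 * n := by
  rw [h.1.1.mem_iff, List.mem_range'_1]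
  omega

theorem IsSecantTree.eoc_mem_Icc {n : ℕ} {t : BinaryTree ℕ} (h : IsSecantTree n t) :
    eoc t ∈ Finset.Icc 2 (2 * n) := by
  obtain ⟨hne, hr⟩ := hasOneChildRightmost_iff.1 h.2
  have h2 := (h.mem_labels.1 (eoc_mem_labels hne)).2
  have hinc := h.1.2
  rcases t with _ | ⟨a, l, r⟩
  · exact absurd rfl hne
  · have h1 := (h.mem_labels.1 (show a ∈ labels (node a l r) by simp [labels])).1
    rw [labelsIncrease_node] at hinc
    have h3 : a < eoc (node a l r) := by
      rw [eoc_node hr.1]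
      exact (chainEnd_mem_labels hr.1).elim (hinc.1 _) (hinc.2.1 _)
    rw [Finset.mem_Icc]
    omega

theorem IsSecantTree.pom_eq_some_iff {n k : ℕ} {t : BinaryTree ℕ} (h : IsSecantTree n t) :
    pom (2 * n) t = some k ↔ HasParent k (2 * n) t :=
  parentLabel_eq_some_iff h.1.2 (h.1.1.nodup_iff.2 List.nodup_range')

theorem IsSecantTree.exists_pom {n : ℕ} (hn : 1 ≤ n) {t : BinaryTree ℕ} (h : IsSecantTree n t) :
    ∃ k ∈ Finset.Icc 1 (2 * n - 1), pom (2 * n) t = some k := by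
  rcases exists_hasParent (h.mem_labels.2 ⟨by omega, le_refl (2 * n)⟩) with hr | ⟨k, hk⟩
  · have := h.1.2.root_le hr 1 (h.mem_labels.2 ⟨le_rfl, by omega⟩)
    omega
  · have h1 := hk.parent_lt h.1.2
    have h2 := h.mem_labels.1 hk.parent_mem
    exact ⟨k, Finset.mem_Icc.2 (by omega), h.pom_eq_some_iff.2 hk⟩

theorem isSecantTree_iff_isForest {n : ℕ} (hn : 1 ≤ n) (t : BinaryTree ℕ) :
    IsSecantTree n t ↔ IsForest 1 (2 * n + 1) {0} (Function.update (fun _ => nil) 0 t) := by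
  have hlab : (labels t).Perm (List.range' 1 (2 * n)) ↔
      (labels t : Multiset ℕ) = (Finset.Ico 1 (2 * n + 1)).val := by
    rw [← Multiset.coe_eq_coe]
    rfl
  constructor
  · rintro ⟨⟨hp, hi⟩, hr⟩
    refine ⟨fun i => ?_, fun i h h0 => absurd (by simpa using h) h0, ?_, fun i hi => ?_, ?_⟩
    · by_cases h : i = 0
      · subst h; simpa using hi
      · simp [h, LabelsIncrease]
    · simpa using (hasOneChildRightmost_iff.1 hr).2
    · have : i ≠ 0 := by simpa using hi
      simp [this]
    · simpa using hlab.1 hp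
  · intro h
    have h1 := h.labels_eq
    simp only [Finset.sum_singleton, Function.update_self] at h1
    have h2 := h.increase 0
    have h3 := h.rightmost
    simp only [Function.update_self] at h2 h3
    refine ⟨⟨hlab.2 h1, h2⟩, hasOneChildRightmost_iff.2 ⟨?_, h3⟩⟩
    rintro rfl
    have := congrArg Multiset.card h1
    simp [labels] at this
    omega

theorem IsForest.eq_update {j M : ℕ} {F : ℕ → BinaryTree ℕ} (h : IsForest j M {0} F) :
    Function.update (fun _ => nil) 0 (F 0) = F := by
  funext i
  by_cases hi : i = 0
  · subst hi; simp
  · rw [h.empty i (by simpa using hi)]; simp [hi]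

theorem encard_secantTree {n : ℕ} (hn : 1 ≤ n) (P : BinaryTree ℕ → Prop) :
    {t | IsSecantTree n t ∧ P t}.encard =
      {F | IsForest 1 (2 * n + 1) {0} F ∧ P (F 0)}.encard := by
  have : {F | IsForest 1 (2 * n + 1) {0} F ∧ P (F 0)} =
      (fun t => Function.update (fun _ => nil) 0 t) '' {t | IsSecantTree n t ∧ P t} := by
    ext F
    simp only [Set.mem_ofPred_eq, Set.mem_image]
    constructor
    · rintro ⟨hF, hP⟩
      refine ⟨F 0, ⟨?_, hP⟩, hF.eq_update⟩
      rwa [isSecantTree_iff_isForest hn, hF.eq_update]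
    · rintro ⟨t, ⟨ht, hP⟩, rfl⟩
      exact ⟨(isSecantTree_iff_isForest hn t).1 ht, by simpa using hP⟩
  rw [this, Set.InjOn.encard_image]
  intro t _ t' _ e
  simpa using congrFun e 0

/-- The root has children, and their slots are the first pair of the chain. No other slot is open,
so `chainOp` is evaluated at 0, where `chainOp_zero` applies. -/
theorem encard_forest_eoc {m M : ℕ} {R : (ℕ → BinaryTree ℕ) → Prop} {φ : ℕ → ℕ} (h2 : 2 ≤ m)
    (hm : m < M) (hR : ∀ j ≤ m, IsStable R j M)
    (hφ : ∀ (B : Finset ℕ) (a : ℕ), 0 ∈ B → B.card = a + 1 →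
      {F | IsForest (m + 1) M B F ∧ R F}.encard = φ a) :
    {F | IsForest 1 M {0} F ∧ eoc (F 0) = m ∧ R F}.encard =
      (transfer ^ (m - 2)) (weight φ) 0 := by
  rw [encard_forests (y := 1) (by omega) (by simp) (by simp), ← chainOp_zero,
    ← encard_chainSet_outer (B := insert 1 {0}) (c := 1) (j := 2) hm hR hφ (by omega) (by simp)
      (by simp) one_ne_zero (by simp), Finset.sum_singleton, Finset.erase_singleton,
    Finset.sum_empty, zero_add]
  refine encard_congr_of_isForest fun F hF => ?_
  rw [attachFork_self, eoc_node (hF.full 1 (by simp) one_ne_zero).1,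
    (hR 1 (by omega)).2 _ F 0 1 hF one_ne_zero]

theorem IsForest.forestParent_iff {j M k N : ℕ} {F : ℕ → BinaryTree ℕ} (h : IsForest j M {0} F) :
    ForestParent k N F ↔ HasParent k N (F 0) := by
  refine ⟨?_, fun h => ⟨0, h⟩⟩
  rintro ⟨z, hz⟩
  by_cases e : z = 0
  · subst e; exact hz
  · rw [h.empty z (by simpa using e)] at hz
    exact hz.elim

theorem encard_secantTree_pom {n k : ℕ} (hn : 1 ≤ n) (P : BinaryTree ℕ → Prop) :
    {t | IsSecantTree n t ∧ P t ∧ pom (2 * n) t = some k}.encard =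
      {F | IsForest 1 (2 * n + 1) {0} F ∧ P (F 0) ∧ ForestParent k (2 * n) F}.encard := by
  rw [encard_congr_of_isForest fun F hF => and_congr_right fun _ => hF.forestParent_iff,
    ← encard_secantTree hn fun t => P t ∧ HasParent k (2 * n) t]
  congr 1
  ext t
  exact and_congr_right fun h => and_congr_right fun _ => h.pom_eq_some_iff

/-- The joint distribution above the diagonal. -/
def upperCount (p q s : ℕ) : ℕ :=
  (transfer ^ p) (weight ((transfer ^ q) (weight ((transfer ^ s) vacuum)))) 0

/-- The distribution of each statistic. -/
def marginalCount (p s : ℕ) : ℕ := (transfer ^ p) (weight ((transfer ^ s) vacuum)) 0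

theorem encard_secantTree_all {n : ℕ} (hn : 1 ≤ n) :
    {t | IsSecantTree n t}.encard = (transfer ^ (2 * n)) vacuum 0 := by
  have := encard_secantTree hn fun _ => True
  simp only [and_true] at this
  rw [this]
  exact encard_isForest (by simp) (by simp) (by omega)

theorem encard_secantTree_eoc {n m p s : ℕ} (hm : m = p + 2) (hs : 2 * n = p + s + 2) :
    {t | IsSecantTree n t ∧ eoc t = m}.encard = marginalCount p s := by
  rw [encard_secantTree (by omega) fun t => eoc t = m]
  have := encard_forest_eoc (m := m) (M := 2 * n + 1) (R := fun _ => True)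
    (φ := (transfer ^ s) vacuum) (by omega) (by omega) (fun j _ => isStable_true j _)
    fun B a h0 hB => by simpa using encard_isForest h0 hB (by omega)
  simp only [and_true] at this
  rw [this, marginalCount, hm, Nat.add_sub_cancel]

theorem encard_secantTree_pom_only {n k p s : ℕ} (hk : k = p + 1) (hs : 2 * n = p + s + 2) :
    {t | IsSecantTree n t ∧ pom (2 * n) t = some k}.encard = marginalCount p s := by
  have h := encard_secantTree_pom (n := n) (k := k) (by omega) fun _ => True
  simp only [true_and] at h
  rw [h, encard_forestParent (d := p) (a := 0) (by simp) (by simp) (by omega) (by omega),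
    marginalCount]
  congr! 6
  omega

/-- As m < k, having k as the parent of 2n is a stable property until m is placed; the remaining
labels are then counted by `encard_forestParent`. -/
theorem encard_treesWith {n m k p q s : ℕ} (hm : m = p + 2) (hk : k = p + q + 3)
    (hs : 2 * n = p + q + s + 4) : (treesWith n m k).encard = upperCount p q s := by
  rw [treesWith, encard_secantTree_pom (by omega) fun t => eoc t = m]
  rw [encard_forest_eoc (m := m) (φ := (transfer ^ q) (weight ((transfer ^ s) vacuum)))
    (by omega) (by omega) (fun j hj => isStable_forestParent (by omega)), upperCount, hm,
    Nat.add_sub_cancel]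
  intro B a h0 hB
  rw [encard_forestParent (d := q) h0 hB (by omega) (by omega)]
  congr! 6
  omega

theorem f_eq_upperCount {n m k p q s : ℕ} (hm : m = p + 2) (hk : k = p + q + 3)
    (hs : 2 * n = p + q + s + 4) : f n m k = upperCount p q s := by
  rw [f, Set.ncard, encard_treesWith hm hk hs]
  rfl

/-! ### From cardinalities of sets of trees to row, column and total sums. -/

theorem sum_ncard_fibers {S : Set (BinaryTree ℕ)} {c : ℕ} (I : Finset ℕ)
    (T : ℕ → Set (BinaryTree ℕ)) (hT : ∀ i ∈ I, (T i).Finite)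
    (hd : ∀ i ∈ I, ∀ i' ∈ I, i ≠ i' → Disjoint (T i) (T i')) (hS : S = ⋃ i ∈ I, T i)
    (hc : S.encard = c) : ∑ i ∈ I, (T i).ncard = c := by
  rw [hS, encard_finset_biUnion _ _ hd,
    Finset.sum_congr rfl fun i hi => ((hT i hi).cast_ncard_eq).symm] at hc
  exact_mod_cast hc

theorem rowSum_f {n m p s : ℕ} (hm : m = p + 2) (hs : 2 * n = p + s + 2) :
    rowSum f n m = marginalCount p s := by
  have := sum_ncard_fibers (Finset.Icc 1 (2 * n - 1)) (fun k => treesWith n m k)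
    (fun k _ => finite_treesWith n m k) (fun k _ k' _ hne => Set.disjoint_left.2 fun t h h' =>
      hne (Option.some_injective _ (h.2.2.symm.trans h'.2.2))) (S := _) ?_
    (encard_secantTree_eoc hm hs)
  · simp only [rowSum, f]
    exact_mod_cast this
  · ext t
    simp only [Set.mem_iUnion]
    constructor
    · rintro ⟨ht, he⟩
      obtain ⟨k, hk, hp⟩ := ht.exists_pom (by omega)
      exact ⟨k, hk, ht, he, hp⟩
    · rintro ⟨k, -, ht, he, -⟩
      exact ⟨ht, he⟩

theorem colSum_f {n k p s : ℕ} (hk : k = p + 1) (hs : 2 * n = p + s + 2) :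
    colSum f n k = marginalCount p s := by
  have := sum_ncard_fibers (Finset.Icc 2 (2 * n)) (fun m => treesWith n m k)
    (fun m _ => finite_treesWith n m k) (fun m _ m' _ hne => Set.disjoint_left.2 fun t h h' =>
      hne (h.2.1.symm.trans h'.2.1)) (S := _) ?_ (encard_secantTree_pom_only hk hs)
  · simp only [colSum, f]
    exact_mod_cast this
  · ext t
    simp only [Set.mem_iUnion]
    constructor
    · rintro ⟨ht, hp⟩
      exact ⟨eoc t, ht.eoc_mem_Icc, ht, rfl, hp⟩
    · rintro ⟨m, -, ht, -, hp⟩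
      exact ⟨ht, hp⟩

theorem totalSum_f {n : ℕ} (hn : 1 ≤ n) : totalSum f n = (transfer ^ (2 * n)) vacuum 0 := by
  have hfin : ∀ m ∈ Finset.Icc 2 (2 * n), {t | IsSecantTree n t ∧ eoc t = m}.Finite := by
    intro m hm
    rw [Finset.mem_Icc] at hm
    rw [← Set.encard_ne_top_iff,
      encard_secantTree_eoc (p := m - 2) (s := 2 * n - m) (by omega) (by omega)]
    exact ENat.natCast_ne_top _
  have := sum_ncard_fibers (Finset.Icc 2 (2 * n)) (fun m => {t | IsSecantTree n t ∧ eoc t = m})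
    hfin (fun m _ m' _ hne => Set.disjoint_left.2 fun t h h' =>
      hne (h.2.symm.trans h'.2)) (S := _) ?_ (encard_secantTree_all hn)
  · rw [← this, totalSum, Nat.cast_sum]
    refine Finset.sum_congr rfl fun m hm => ?_
    rw [Finset.mem_Icc] at hm
    have h := rowSum_f (n := n) (m := m) (p := m - 2) (s := 2 * n - m) (by omega) (by omega)
    rw [rowSum] at h
    rw [h, Set.ncard, encard_secantTree_eoc (p := m - 2) (s := 2 * n - m) (by omega) (by omega)]
    rfl
  · ext t
    simp only [Set.mem_iUnion]
    constructor
    · intro ht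
      exact ⟨eoc t, ht.eoc_mem_Icc, ht, rfl⟩
    · rintro ⟨m, -, ht, -⟩
      exact ht

/-! ### The relations for the counting numbers -/

/-- The double commutator relation for the first `weight`; moving m with k and n fixed exchanges p
and q. -/
theorem upperCount_relation_left (p q s : ℕ) :
    upperCount (p + 2) q s + upperCount p (q + 2) s + 4 * upperCount p q s =
      2 * upperCount (p + 1) (q + 1) s := by
  have := transfer_pow_weight_relation p ((transfer ^ q) (weight ((transfer ^ s) vacuum))) 0
  simpa only [upperCount, pow_succ' transfer q, pow_succ' transfer (q + 1),
    Module.End.mul_apply] using this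

/-- The same relation for the second `weight`; moving k with m and n fixed exchanges q and s. -/
theorem upperCount_relation_right (p q s : ℕ) :
    upperCount p (q + 2) s + upperCount p q (s + 2) + 4 * upperCount p q s =
      2 * upperCount p (q + 1) (s + 1) := by
  have h : (transfer ^ (q + 2)) (weight ((transfer ^ s) vacuum)) +
      (transfer ^ q) (weight ((transfer ^ (s + 2)) vacuum)) +
      4 • (transfer ^ q) (weight ((transfer ^ s) vacuum)) =
      2 • (transfer ^ (q + 1)) (weight ((transfer ^ (s + 1)) vacuum)) := by
    funext b
    have := transfer_pow_weight_relation q ((transfer ^ s) vacuum) b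
    simpa only [pow_succ' transfer s, pow_succ' transfer (s + 1), Module.End.mul_apply,
      Pi.add_apply, Pi.smul_apply, smul_eq_mul] using this
  have := congrFun (congrArg (fun φ => (transfer ^ p) (weight φ)) h) 0
  simpa only [upperCount, map_add, map_nsmul, Pi.add_apply, Pi.smul_apply, smul_eq_mul] using this

theorem marginalCount_relation (p s : ℕ) :
    marginalCount (p + 2) s + marginalCount p (s + 2) + 4 * marginalCount p s =
      2 * marginalCount (p + 1) (s + 1) := by
  have := transfer_pow_weight_relation p ((transfer ^ s) vacuum) 0
  simpa only [marginalCount, pow_succ' transfer s, pow_succ' transfer (s + 1),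
    Module.End.mul_apply] using this

theorem weight_vacuum : weight vacuum = vacuum := by
  funext a
  rcases a with _ | a <;> simp [weight_apply, vacuum]

/-- The function `transfer vacuum` is supported at a = 1, where the weight is 3; hence the factor 3
in the next-to-last column. -/
theorem weight_transfer_vacuum : weight (transfer vacuum) = 3 • transfer vacuum := by
  funext a
  rcases a with _ | _ | a <;> simp [weight_apply, transfer_apply, vacuum]

theorem upperCount_zero_left (q s : ℕ) : upperCount 0 q s = marginalCount q s := by
  simp [upperCount, marginalCount, weight_apply]

/-- One `transfer` evaluated at 0 reads off the value at 1, where the weight is 3. -/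
theorem upperCount_one_left (q s : ℕ) : upperCount 1 q s = 3 * marginalCount (q + 1) s := by
  rw [upperCount, marginalCount, pow_one, pow_succ', Module.End.mul_apply, transfer_apply,
    transfer_apply]
  simp [weight_apply]

theorem upperCount_zero_right (p q : ℕ) : upperCount p q 0 = marginalCount p q := by
  rw [upperCount, marginalCount, pow_zero, Module.End.one_apply, weight_vacuum]

theorem upperCount_one_right (p q : ℕ) : upperCount p q 1 = 3 * marginalCount p (q + 1) := by
  rw [upperCount, marginalCount, pow_one, weight_transfer_vacuum, map_nsmul, map_nsmul, map_nsmul,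
    pow_succ transfer q, Module.End.mul_apply]
  rfl

theorem marginalCount_zero (s : ℕ) : marginalCount 0 s = (transfer ^ s) vacuum 0 := by
  simp [marginalCount, weight_apply]

theorem marginalCount_one (s : ℕ) : marginalCount 1 s = 3 * (transfer ^ (s + 1)) vacuum 0 := by
  rw [marginalCount, pow_one, pow_succ', Module.End.mul_apply, transfer_apply,
    transfer_apply]
  simp [weight_apply]

theorem fwdDiff_fwdDiff (x : ℕ → ℤ) (i : ℕ) :
    fwdDiff 1 (fwdDiff 1 x) i = x (i + 2) - 2 * x (i + 1) + x i := by
  simp only [fwdDiff, add_assoc, one_add_one_eq_two]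
  ring

theorem differenceSystems_f : DifferenceSystems f where
  R1 n m k hn hm hmk hk := by
    rw [fwdDiff_fwdDiff]
    obtain ⟨p, rfl⟩ := Nat.exists_eq_add_of_le' hm
    obtain ⟨q, rfl⟩ := Nat.exists_eq_add_of_le' hmk
    obtain ⟨s, hs⟩ := Nat.exists_eq_add_of_le' hk
    rw [f_eq_upperCount (p := p + 2) (q := q) (s := s) (by omega) (by omega) (by omega),
      f_eq_upperCount (p := p + 1) (q := q + 1) (s := s) (by omega) (by omega) (by omega),
      f_eq_upperCount (p := p) (q := q + 2) (s := s) (by omega) (by omega) (by omega),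
      f_eq_upperCount (p := p) (q := q) (s := s) (by omega) (by omega) (by omega)]
    have := upperCount_relation_left p q s
    zify at this
    linarith
  R2 n m k hn hm hmk hk := by
    rw [fwdDiff_fwdDiff]
    obtain ⟨p, rfl⟩ := Nat.exists_eq_add_of_le' hm
    obtain ⟨q, rfl⟩ := Nat.exists_eq_add_of_le' hmk
    obtain ⟨s, hs⟩ := Nat.exists_eq_add_of_le' hk
    rw [f_eq_upperCount (p := p) (q := q + 2) (s := s) (by omega) (by omega) (by omega),
      f_eq_upperCount (p := p) (q := q + 1) (s := s + 1) (by omega) (by omega) (by omega),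
      f_eq_upperCount (p := p) (q := q) (s := s + 2) (by omega) (by omega) (by omega),
      f_eq_upperCount (p := p) (q := q) (s := s) (by omega) (by omega) (by omega)]
    have := upperCount_relation_right p q s
    zify at this
    linarith

theorem borderValues_f : BorderValues f where
  firstRow n k hn h3 hk := by
    rw [f_eq_upperCount (p := 0) (q := k - 3) (s := 2 * n - 1 - k) (by omega) (by omega) (by omega),
      colSum_f (p := k - 3) (s := 2 * n - 1 - k) (by omega) (by omega),
      rowSum_f (p := k - 3) (s := 2 * n - 1 - k) (by omega) (by omega), upperCount_zero_left]
    exact ⟨rfl, rfl⟩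
  secondRow n k hn h4 hk := by
    rw [f_eq_upperCount (p := 1) (q := k - 4) (s := 2 * n - 1 - k) (by omega) (by omega) (by omega),
      f_eq_upperCount (p := 0) (q := k - 4 + 1) (s := 2 * n - 1 - k)
        (by omega) (by omega) (by omega), upperCount_zero_left, upperCount_one_left]
    push_cast
    rfl
  lastCol n m hn h2 hm := by
    rw [f_eq_upperCount (p := m - 2) (q := 2 * n - 2 - m) (s := 0)
        (by omega) (by omega) (by omega),
      colSum_f (p := m - 2) (s := 2 * n - 2 - m) (by omega) (by omega),
      rowSum_f (p := m - 2) (s := 2 * n - 2 - m) (by omega) (by omega), upperCount_zero_right]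
    exact ⟨rfl, rfl⟩
  nextToLastCol n m hn h2 hm := by
    rw [f_eq_upperCount (p := m - 2) (q := 2 * n - 3 - m) (s := 1)
        (by omega) (by omega) (by omega),
      f_eq_upperCount (p := m - 2) (q := 2 * n - 3 - m + 1) (s := 0)
        (by omega) (by omega) (by omega), upperCount_zero_right, upperCount_one_right]
    push_cast
    rfl

theorem sumRelations_f : SumRelations f where
  col_one_init := by
    rw [colSum_f (p := 0) (s := 0) (by omega) (by omega), marginalCount_zero]
    rfl
  col_one n hn := by
    rw [colSum_f (p := 0) (s := 2 * (n - 1)) (by omega) (by omega), totalSum_f (by omega),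
      marginalCount_zero]
    exact ⟨rfl, by rw [← transfer_pow_eq_secantNumber]; norm_cast⟩
  col_two n hn := by
    rw [colSum_f (p := 1) (s := 2 * n - 3) (by omega) (by omega), totalSum_f (by omega),
      marginalCount_one, show 2 * n - 3 + 1 = 2 * (n - 1) by omega]
    push_cast
    rfl
  R3 n m hn h2 hm := by
    rw [fwdDiff_fwdDiff]
    obtain ⟨p, rfl⟩ := Nat.exists_eq_add_of_le' h2
    obtain ⟨s, hs⟩ := Nat.exists_eq_add_of_le' hm
    rw [rowSum_f (p := p + 2) (s := s) (by omega) (by omega),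
      rowSum_f (p := p + 1) (s := s + 1) (by omega) (by omega),
      rowSum_f (p := p) (s := s + 2) (by omega) (by omega),
      rowSum_f (p := p) (s := s) (by omega) (by omega)]
    have := marginalCount_relation p s
    zify at this
    linarith
  R4 n k hn h1 hk := by
    rw [fwdDiff_fwdDiff]
    obtain ⟨p, rfl⟩ := Nat.exists_eq_add_of_le' h1
    obtain ⟨s, hs⟩ := Nat.exists_eq_add_of_le' hk
    rw [colSum_f (p := p + 2) (s := s) (by omega) (by omega),
      colSum_f (p := p + 1) (s := s + 1) (by omega) (by omega),
      colSum_f (p := p) (s := s + 2) (by omega) (by omega),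
      colSum_f (p := p) (s := s) (by omega) (by omega)]
    have := marginalCount_relation p s
    zify at this
    linarith

/-! ### The algorithm -/

/-- The bound N confines the recurrence to the range where the relations hold; the second value is
required only if that range contains it, as a column of the upper triangle may have a single entry.
-/
theorem propagate_eq {b₀ b₁ : ℤ} {q x : ℕ → ℤ} {N : ℕ} (h0 : x 0 = b₀) (h1 : 1 ≤ N → x 1 = b₁)
    (h : ∀ i, i + 2 ≤ N → x (i + 2) = 2 * x (i + 1) - x i - 4 * q i) {i : ℕ} (hi : i ≤ N) :
    propagate b₀ b₁ q i = x i := by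
  induction i using Nat.twoStepInduction with
  | zero => exact h0.symm
  | one => exact (h1 hi).symm
  | more i ih ih' => rw [propagate, ih (by omega), ih' (by omega), h i hi]

section Algorithm

variable {g : ℕ → ℕ → ℕ → ℤ}

/-- Both sums equal the same entry in the last column of the next size. -/
theorem BorderValues.rowSum_eq_colSum (hb : BorderValues g) {n m : ℕ} (hn : 1 ≤ n) (h2 : 2 ≤ m)
    (hm : m ≤ 2 * n) : rowSum g n m = colSum g n (m - 1) :=
  (hb.lastCol (n + 1) m (by omega) h2 (by omega)).2

theorem Level.Computes.total_eq {n : ℕ} {p : Level} (hp : p.Computes g n) :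
    p.total n = totalSum g n := by
  rw [Level.total, totalSum, Finset.sum_comm]
  refine Finset.sum_congr rfl fun k hk => ?_
  rw [Finset.mem_Icc] at hk
  exact hp.col_eq k hk.1 hk.2

theorem Level.Computes.nextCol_eq (hb : BorderValues g) (hs : SumRelations g) {n : ℕ} (hn : 1 ≤ n)
    {p : Level} (hp : p.Computes g n) (s : SumRule) {i : ℕ} (hi : i ≤ 2 * n) :
    nextCol s n p (i + 1) = colSum g (n + 1) (i + 1) := by
  have h0 : colSum g (n + 1) (0 + 1) = p.total n := by
    rw [hp.total_eq]; exact (hs.col_one (n + 1) (by omega)).1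
  have h1 : 1 ≤ 2 * n → colSum g (n + 1) (1 + 1) = 3 * p.total n := fun _ => by
    rw [hp.total_eq]; exact hs.col_two (n + 1) (by omega)
  cases s with
  | R3 =>
    refine propagate_eq (x := fun i => colSum g (n + 1) (i + 1)) h0 h1 (fun i hi => ?_) hi
    have h := hs.R3 (n + 1) (i + 2) (by omega) (by omega) (by omega)
    rw [fwdDiff_fwdDiff, hb.rowSum_eq_colSum (by omega) (by omega) (by omega),
      hb.rowSum_eq_colSum (by omega) (by omega) (by omega),
      hb.rowSum_eq_colSum (by omega) (by omega) (by omega)] at h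
    simp only [Nat.add_succ_sub_one, Nat.add_sub_cancel, add_assoc, Nat.reduceAdd] at h ⊢
    rw [hp.row_eq (i + 2) (by omega) (by omega)]
    linarith
  | R4 =>
    refine propagate_eq (x := fun i => colSum g (n + 1) (i + 1)) h0 h1 (fun i hi => ?_) hi
    have h := hs.R4 (n + 1) (i + 1) (by omega) (by omega) (by omega)
    rw [fwdDiff_fwdDiff] at h
    simp only [Nat.add_sub_cancel, add_assoc, Nat.reduceAdd] at h ⊢
    rw [hp.col_eq (i + 1) (by omega) (by omega)]
    linarith

theorem Level.Computes.nextUpper_eq (hd : DifferenceSystems g) (hb : BorderValues g) {n : ℕ}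
    (hn : 1 ≤ n) {p : Level} (hp : p.Computes g n) (e : EntryRule) {m k : ℕ} (h2 : 2 ≤ m)
    (hmk : m < k) (hk : k ≤ 2 * n + 1) : nextUpper e n p m k = g (n + 1) m k := by
  cases e with
  | R1 =>
    have hcol := hp.col_eq (k - 2) (by omega) (by omega)
    have hrow := (hb.firstRow (n + 1) k (by omega) (by omega) (by omega)).1
    rw [Nat.add_sub_cancel, ← hcol] at hrow
    have key := propagate_eq (b₀ := p.col (k - 2)) (b₁ := 3 * p.col (k - 2))
      (q := fun i => p.upper (i + 2) (k - 2)) (x := fun i => g (n + 1) (i + 2) k) (N := k - 3)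
      hrow (fun h => ?_) (fun i hi => ?_) (i := m - 2) (by omega)
    · simpa only [nextUpper, Nat.sub_add_cancel h2] using key
    · rw [← hrow]
      exact hb.secondRow (n + 1) k (by omega) (by omega) (by omega)
    · have h := hd.R1 (n + 1) (i + 2) k (by omega) (by omega) (by omega) (by omega)
      rw [fwdDiff_fwdDiff] at h
      simp only [Nat.add_sub_cancel, add_assoc, Nat.reduceAdd] at h ⊢
      rw [hp.upper_eq (i + 2) (k - 2) (by omega) (by omega) (by omega)]
      linarith
  | R2 =>
    have hlast := (hb.lastCol (n + 1) m (by omega) h2 (by omega)).1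
    rw [Nat.add_sub_cancel, ← hp.row_eq m h2 (by omega),
      show 2 * (n + 1) - 1 = 2 * n + 1 by omega] at hlast
    -- The index i stands for the column 2n + 1 - i: a second difference is symmetric, so the
    -- recurrence also runs to the left.
    have key := propagate_eq (b₀ := p.row m) (b₁ := 3 * p.row m)
      (q := fun i => p.upper m (2 * n - 1 - i)) (x := fun i => g (n + 1) m (2 * n + 1 - i))
      (N := 2 * n - m) hlast (fun h => ?_) (fun i hi => ?_) (i := 2 * n + 1 - k) (by omega)
    · simpa only [nextUpper, Nat.sub_sub_self hk] using key
    · rw [← hlast]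
      exact hb.nextToLastCol (n + 1) m (by omega) h2 (by omega)
    · have h := hd.R2 (n + 1) m (2 * n - 1 - i) (by omega) h2 (by omega) (by omega)
      rw [fwdDiff_fwdDiff, show 2 * n - 1 - i + 2 = 2 * n + 1 - i by omega,
        show 2 * n - 1 - i + 1 = 2 * n + 1 - (i + 1) by omega, Nat.add_sub_cancel,
        ← hp.upper_eq m (2 * n - 1 - i) h2 (by omega) (by omega),
        show 2 * n - 1 - i = 2 * n + 1 - (i + 2) by omega] at h
      rw [show 2 * n - 1 - i = 2 * n + 1 - (i + 2) by omega]
      linarith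

theorem algorithm_computes (hd : DifferenceSystems g) (hb : BorderValues g) (hs : SumRelations g)
    (s : SumRule) (e : EntryRule) {n : ℕ} (hn : 1 ≤ n) : (algorithm s e n).Computes g n := by
  induction n, hn using Nat.le_induction with
  | base =>
    refine ⟨fun m h2 hm => ?_, fun k h1 hk => ?_, fun m k _ _ _ => by omega⟩
    · obtain rfl : m = 2 := by omega
      -- The initial condition only concerns a column sum; the row sum of size 2 is reached through
      -- the last column of size 4.
      rw [hb.rowSum_eq_colSum le_rfl le_rfl le_rfl]
      exact hs.col_one_init.symm
    · obtain rfl : k = 1 := by omega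
      exact hs.col_one_init.symm
  | succ n hn ih =>
    obtain ⟨n, rfl⟩ := Nat.exists_eq_add_of_le' hn
    have hcol := fun i (hi : i ≤ 2 * (n + 1)) => ih.nextCol_eq hb hs (by omega) s hi
    refine ⟨fun m h2 hm => ?_, fun k h1 hk => ?_, fun m k h2 hmk hk => ?_⟩
    · obtain ⟨i, rfl⟩ := Nat.exists_eq_add_of_le' h2
      rw [hb.rowSum_eq_colSum (by omega) h2 hm]
      refine Eq.trans ?_ (hcol i (by omega))
      -- Under either rule, rows and columns are the same propagated sequence with indices shifted
      -- by one.
      cases s <;> rfl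
    · obtain ⟨i, rfl⟩ := Nat.exists_eq_add_of_le' h1
      exact hcol i (by omega)
    · exact ih.nextUpper_eq hd hb (by omega) e h2 hmk (by omega)

end Algorithm

end SecantTree

theorem theorem1p4 :
    -- the counting numbers satisfy the relations
    (SecantTree.DifferenceSystems SecantTree.f ∧ SecantTree.BorderValues SecantTree.f ∧
      SecantTree.SumRelations SecantTree.f) ∧
    -- the relations alone force the output of the algorithm, whichever rules are chosen
    (∀ g : ℕ → ℕ → ℕ → ℤ, SecantTree.DifferenceSystems g → SecantTree.BorderValues g →
      SecantTree.SumRelations g → ∀ (s : SecantTree.SumRule) (e : SecantTree.EntryRule) (n : ℕ),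
        1 ≤ n → (SecantTree.algorithm s e n).Computes g n) ∧
    -- hence the algorithm computes the row sums, column sums and upper triangles of the matrices
    (∀ (s : SecantTree.SumRule) (e : SecantTree.EntryRule) (n : ℕ),
      1 ≤ n → (SecantTree.algorithm s e n).Computes SecantTree.f n) := by
  exact ⟨⟨SecantTree.differenceSystems_f, SecantTree.borderValues_f, SecantTree.sumRelations_f⟩,
    fun _ hd hb hs s e _ hn => SecantTree.algorithm_computes hd hb hs s e hn,
    fun s e _ hn => SecantTree.algorithm_computes SecantTree.differenceSystems_f
      SecantTree.borderValues_f SecantTree.sumRelations_f s e hn⟩
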